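/- Let $a>0$ and $0<t<\frac{1}{a+4}$. Let $Q(x,y)=\sum_{n,i,j\ge 0}q(i,j;n)\,x^iy^jt^n$, where $q(i,j;n)$ is the weighted number of walks of length $n$ from $(0,0)$ to $(i,j)$ that stay in the quadrant $\mathbb{Z}_{\ge0}^2$ and use the steps $(1,0),(0,1),(-1,0),(0,-1)$ with weight $1$ and the step $(1,1)$ with weight $a$. For $\Im\tau>0$ let $$\theta(z|\tau)=\sum_{n\ge 0}(-1)^n e^{i\pi\tau(n+\frac12)^2}\bigl(e^{(2n+1)iz}-e^{-(2n+1)iz}\bigr),$$ and let $\theta'$ be its derivative in $z$. Let $c,\gamma,\tau\in\mathbb{C}$ with $\gamma,\tau\in i\mathbb{R}$ and $0<\Im(2\gamma)<\Im(\pi\tau)$ satisfy $$ac^3=-\frac{\theta(4\gamma|\tau)}{\theta(2\gamma|\tau)},\qquad c^2=\frac{\theta(3\gamma|\tau)}{\theta(\gamma|\tau)},\qquad \frac ct=4\frac{\theta'(\gamma|\tau)\theta(2\gamma|\tau)}{\theta'(0|\tau)\theta(\gamma|\tau)}-2\frac{\theta'(2\gamma|\tau)}{\theta'(0|\tau)},$$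 and put $$X(z)=c\,\frac{\theta(z|\tau)\theta(z+\gamma|\tau)}{\theta(z-\gamma|\tau)\theta(z+2\gamma|\tau)},\qquad Y(z)=X(-z).$$ Let $\Omega_X$ be the connected component of $\{z\in\mathbb{C}:|X(z)|<1\}$ containing $-\gamma/2$, and $\Omega_Y$ the connected component of $\{z\in\mathbb{C}:|Y(z)|<1\}$ containing $\gamma/2$. Then there is a unique meromorphic function $J$ on $\mathbb{C}$ such that $$J(z)=\frac1{2t}-atX(z)Q(X(z),0)-X(z)-\frac1{X(z)}\quad\text{on }\Omega_X,$$ $$J(z)=-\Bigl(\frac1{2t}-atY(z)Q(0,Y(z))-Y(z)-\frac1{Y(z)}\Bigr)\quad\text{on }\Omega_Y,$$ and it is given by $$J(z)=\frac{\theta'(0|\frac{\gamma}{\pi})\,\theta(2\gamma|\tau)\,\theta(z+\frac{\pi}{2}|\frac{\gamma}{\pi})}{c\,\theta(\frac{\pi}{2}|\frac{\gamma}{\pi})\,\theta'(0|\tau)\,\theta(z|\frac{\gamma}{\pi})}.$$ Consequently $Q(x,0)$ is given parametrically for $0<|x|<1$: every such $x$ equals $X(z)$ for some $z\in\Omega_X$,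 and for each such $z$ $$Q(x,0)=\frac{1}{atx}\Bigl(\frac1{2t}-x-\frac1x-J(z)\Bigr).$$ -/

import Mathlib

namespace QuadrantWalk

noncomputable section

/-- The Jacobi theta function
`θ(z | τ) = ∑_{n ≥ 0} (-1)^n e^{iπτ(n+1/2)^2} (e^{(2n+1)iz} - e^{-(2n+1)iz})`. -/
def theta (z τ : ℂ) : ℂ :=
  ∑' n : ℕ, (-1 : ℂ) ^ n * Complex.exp (Complex.I * Real.pi * τ * ((n : ℂ) + 1 / 2) ^ 2) *
    (Complex.exp ((2 * (n : ℂ) + 1) * Complex.I * z) -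
      Complex.exp (-((2 * (n : ℂ) + 1) * Complex.I * z)))

/-- The derivative `θ'(z | τ)` with respect to the first argument. -/
def theta' (z τ : ℂ) : ℂ := deriv (fun w => theta w τ) z

/-- The steps N, E, S, W and NE. -/
def steps : Finset (ℤ × ℤ) := {(0, 1), (1, 0), (0, -1), (-1, 0), (1, 1)}

/-- The weight of a step: `a` for NE and `1` for the other steps. -/
def stepWeight (a : ℝ) (s : ℤ × ℤ) : ℝ := if s = (1, 1) then a else 1

/-- The position reached after the first `k` steps of the walk `w` started at the origin. -/
def position {n : ℕ} (w : Fin n → ℤ × ℤ) (k : ℕ) : ℤ × ℤ :=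
  ∑ m : Fin n with m.val < k, w m

/-- The walks of length `n` that start at the origin, stay in the quadrant and end at `(i, j)`. -/
def walks (i j n : ℕ) : Finset (Fin n → ℤ × ℤ) :=
  {w ∈ Fintype.piFinset (fun _ : Fin n => steps) |
    (∀ k : Fin (n + 1), 0 ≤ (position w k).1 ∧ 0 ≤ (position w k).2) ∧
      position w n = ((i : ℤ), (j : ℤ))}

/-- The weighted number `q((0,0),(i,j);n)` of quadrant walks. -/
def walkCount (a : ℝ) (i j n : ℕ) : ℝ :=
  ∑ w ∈ walks i j n, ∏ m : Fin n, stepWeight a (w m)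

/-- The generating function `Q(x, y) = Q(x, y; t)`. -/
def Q (a t : ℝ) (x y : ℂ) : ℂ :=
  ∑' n : ℕ, ∑' i : ℕ, ∑' j : ℕ, (walkCount a i j n : ℂ) * x ^ i * y ^ j * (t : ℂ) ^ n

/-- The triple `(c, γ, τ)` attached to the parameters `(a, t)`. -/
structure IsUniformizingTriple (a t : ℝ) (c γ τ : ℂ) : Prop where
  gamma_re : γ.re = 0
  tau_re : τ.re = 0
  gamma_pos : 0 < (2 * γ).im
  gamma_lt : (2 * γ).im < (Real.pi * τ).im
  eq_ac3 : a * c ^ 3 = -(theta (4 * γ) τ / theta (2 * γ) τ)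
  eq_c2 : c ^ 2 = theta (3 * γ) τ / theta γ τ
  eq_c_on_t : c / t = 4 * ((theta' γ τ * theta (2 * γ) τ) / (theta' 0 τ * theta γ τ)) -
    2 * (theta' (2 * γ) τ / theta' 0 τ)

/-- `X(z)`; its poles are the zeros of the denominator. -/
def X (c γ τ z : ℂ) : ℂ :=
  c * ((theta z τ * theta (z + γ) τ) / (theta (z - γ) τ * theta (z + 2 * γ) τ))

/-- `Y(z)`; its poles are the zeros of the denominator. -/
def Y (c γ τ z : ℂ) : ℂ :=
  c * ((theta z τ * theta (z - γ) τ) / (theta (z + γ) τ * theta (z - 2 * γ) τ))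

/-- The region `Ω₋₁ ∪ Ω₀`: the connected component of `{z : |X(z)| < 1}` (the poles of `X` being
left out) that contains `-γ/2`. -/
def regionX (c γ τ : ℂ) : Set ℂ :=
  connectedComponentIn
    {z : ℂ | theta (z - γ) τ * theta (z + 2 * γ) τ ≠ 0 ∧ ‖X c γ τ z‖ < 1} (-(γ / 2))

/-- The region `Ω₀ ∪ Ω₁`: the connected component of `{z : |Y(z)| < 1}` (the poles of `Y` being
left out) that contains `γ/2`. -/
def regionY (c γ τ : ℂ) : Set ℂ :=
  connectedComponentIn
    {z : ℂ | theta (z + γ) τ * theta (z - 2 * γ) τ ≠ 0 ∧ ‖Y c γ τ z‖ < 1} (γ / 2)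

/-- `J` is (a representative of) the decoupled function: a meromorphic function on `ℂ` that is given
by the generating function `Q(x, 0)` on `Ω₋₁ ∪ Ω₀` and by `Q(0, y)` on `Ω₀ ∪ Ω₁`, away from the
zeros of `X` and `Y`, respectively. -/
structure IsDecoupledFunction (a t : ℝ) (c γ τ : ℂ) (J : ℂ → ℂ) : Prop where
  meromorphic : Meromorphic J
  eq_on_regionX : ∀ z ∈ regionX c γ τ, X c γ τ z ≠ 0 →
    J z = 1 / (2 * t) - a * t * X c γ τ z * Q a t (X c γ τ z) 0 - X c γ τ z - 1 / X c γ τ z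
  eq_on_regionY : ∀ z ∈ regionY c γ τ, Y c γ τ z ≠ 0 →
    J z = -(1 / (2 * t) - a * t * Y c γ τ z * Q a t 0 (Y c γ τ z) - Y c γ τ z - 1 / Y c γ τ z)

/-- The explicit theta quotient. -/
def thetaQuotient (c γ τ z : ℂ) : ℂ :=
  (theta' 0 (γ / Real.pi) * theta (2 * γ) τ * theta (z + Real.pi / 2) (γ / Real.pi)) /
    (c * theta (Real.pi / 2) (γ / Real.pi) * theta' 0 τ * theta z (γ / Real.pi))

end

end QuadrantWalk

/-!
The elliptic function `X` and its reflection `Y z = X (-z)` uniformize the zero set of the kernel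
`1 - t (x + y + 1/x + 1/y + a x y)`. Where `|X|, |Y| < 1`, the kernel equation of the walk therefore
splits as `regularPart (X z) - 1/X z = -(regularPart (Y z) - 1/Y z)`: the left side continues to the
whole plane as an odd function `J` which is `π`-periodic and satisfies `J (-γ - z) = J z`, because
`X (-γ - z) = X z`. The theta quotient has the same symmetries, and its pole at `0` cancels that of
`1/X`, so the difference is holomorphic, `π`-periodic and invariant under `z ↦ -γ - z` in the strip
`-γ.im ≤ z.im ≤ 0`. This reflection exchanges the two boundary lines, so the modulus is maximal on
the real line, across which the difference continues as an odd function: the maximum is an interior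
one, the difference is constant, and an odd constant vanishes.
-/

namespace QuadrantWalk

open Filter Topology Set
open Complex (I exp)
open Real (pi_ne_zero pi_pos)
open scoped Real

section Liouville

lemma meromorphicOrderAt_div_nonneg {f g : ℂ → ℂ} {z : ℂ} (hf : AnalyticAt ℂ f z)
    (hg : AnalyticAt ℂ g z) (h : g z = 0 → f z = 0 ∧ deriv g z ≠ 0) :
    0 ≤ meromorphicOrderAt (f / g) z := by
  by_cases hgz : g z = 0
  · obtain ⟨hfz, hg'⟩ := h hgz
    rw [meromorphicOrderAt_div hf.meromorphicAt hg.meromorphicAt, hf.meromorphicOrderAt_eq,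
      hg.meromorphicOrderAt_eq, hg.analyticOrderAt_eq_one_of_zero_deriv_ne_zero hgz hg']
    have hf_pos : 1 ≤ analyticOrderAt f z :=
      Order.one_le_iff_pos.2 (pos_iff_ne_zero.2 (hf.analyticOrderAt_ne_zero.2 hfz))
    rcases eq_or_ne (analyticOrderAt f z) ⊤ with htop | htop
    · simp [htop]
    · lift analyticOrderAt f z to ℕ using htop with n
      simp only [Nat.one_le_cast, ENat.map_natCast, ENat.map_one] at hf_pos ⊢
      norm_cast
      lia
  · exact (hf.div hg hgz).meromorphicOrderAt_nonneg

lemma exists_analyticOnNhd_eventuallyEq {E : Type*} [NormedAddCommGroup E] [NormedSpace ℂ E]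
    {F : ℂ → E} {U : Set ℂ} (hF : MeromorphicOn F U) (h : ∀ z ∈ U, 0 ≤ meromorphicOrderAt F z) :
    ∃ G : ℂ → E, AnalyticOnNhd ℂ G U ∧ ∀ z ∈ U, F =ᶠ[𝓝[≠] z] G := by
  refine ⟨toMeromorphicNFOn F U, fun z hz => ?_, fun z hz =>
    (hF.toMeromorphicNFOn_eq_self_on_nhdsNE hz).symm⟩
  have hNF : MeromorphicNFAt (toMeromorphicNFOn F U) z := meromorphicNFOn_toMeromorphicNFOn F U hz
  refine hNF.meromorphicOrderAt_nonneg_iff_analyticAt.1 ?_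
  rw [meromorphicOrderAt_toMeromorphicNFOn hF hz]
  exact h z hz

lemma comp_homeomorph_eventuallyEq {α β : Type*} [TopologicalSpace α] [TopologicalSpace β]
    [T2Space β] {F G : α → β} (φ : α ≃ₜ α) {σ : β → β} (hσ : Continuous σ) {z : α}
    [(𝓝[≠] z).NeBot] (hF : ∀ᶠ w in 𝓝[≠] z, F (φ w) = σ (F w)) (hz : F =ᶠ[𝓝[≠] z] G)
    (hφz : F =ᶠ[𝓝[≠] φ z] G) (hG : ContinuousAt G z) (hGφ : ContinuousAt G (φ z)) :
    G ∘ φ =ᶠ[𝓝 z] σ ∘ G := by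
  refine ((hGφ.comp φ.continuous.continuousAt).eventuallyEq_nhds_iff_eventuallyEq_nhdsNE
    (hσ.continuousAt.comp hG)).1 ?_
  rw [← φ.map_punctured_nhds_eq, EventuallyEq, eventually_map] at hφz
  filter_upwards [hF, hz, hφz] with w hw hFz hFφ
  rw [Function.comp_apply, Function.comp_apply, ← hFφ, hw, hFz]

lemma periodic_of_mem_lattice {α : Type*} {L : PeriodPair} {f : ℂ → α}
    (h₁ : Function.Periodic f L.ω₁) (h₂ : Function.Periodic f L.ω₂) {l : ℂ} (hl : l ∈ L.lattice) :
    Function.Periodic f l := by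
  obtain ⟨m, n, rfl⟩ := PeriodPair.mem_lattice.1 hl
  exact (h₁.int_mul m).add_period (h₂.int_mul n)

variable (L : PeriodPair)

lemma exists_isCompact_forall_add_mem :
    ∃ K : Set ℂ, IsCompact K ∧ ∀ z, ∃ l ∈ L.lattice, z + l ∈ K := by
  refine ⟨_, (ZSpan.fundamentalDomain_isBounded L.basis).isCompact_closure, fun z =>
    ⟨-(ZSpan.floor L.basis z : ℂ), ?_, ?_⟩⟩
  · rw [L.lattice_eq_span_range_basis]
    exact neg_mem (SetLike.coe_mem _)
  · rw [← sub_eq_add_neg]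
    exact subset_closure (ZSpan.fract_mem_fundamentalDomain L.basis z)

lemma apply_eq_apply_of_doublyPeriodic {E : Type*} [NormedAddCommGroup E] [NormedSpace ℂ E]
    {f : ℂ → E} (hf : Differentiable ℂ f) (h₁ : Function.Periodic f L.ω₁)
    (h₂ : Function.Periodic f L.ω₂) (z w : ℂ) : f z = f w := by
  obtain ⟨K, hK, hKL⟩ := exists_isCompact_forall_add_mem L
  refine hf.apply_eq_apply_of_bounded ((hK.image hf.continuous).isBounded.subset ?_) z w
  rintro _ ⟨v, rfl⟩
  obtain ⟨l, hl, hvl⟩ := hKL v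
  exact ⟨v + l, hvl, periodic_of_mem_lattice h₁ h₂ hl v⟩

lemma eventuallyEq_const_of_doublyPeriodic {E : Type*} [NormedAddCommGroup E] [NormedSpace ℂ E]
    {F : ℂ → E} (hF : Meromorphic F) (h₁ : Function.Periodic F L.ω₁)
    (h₂ : Function.Periodic F L.ω₂)
    (hord : ∀ z, ∃ l ∈ L.lattice, 0 ≤ meromorphicOrderAt F (z + l)) :
    ∃ κ, ∀ z, F =ᶠ[𝓝[≠] z] fun _ => κ := by
  have hord_nonneg (z : ℂ) : 0 ≤ meromorphicOrderAt F z := by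
    obtain ⟨l, hl, hzl⟩ := hord z
    rwa [← meromorphicOrderAt_comp_add_const_eq_meromorphicOrderAt,
      show F ∘ (· + l) = F from funext (periodic_of_mem_lattice h₁ h₂ hl)] at hzl
  obtain ⟨G, hGan, hFG⟩ :=
    exists_analyticOnNhd_eventuallyEq (U := univ) (fun z _ => hF z) fun z _ => hord_nonneg z
  simp only [mem_univ, forall_const] at hFG
  have hG : Differentiable ℂ G := fun z => (hGan z (mem_univ z)).differentiableAt
  have periodic_G {ω : ℂ} (hω : Function.Periodic F ω) : Function.Periodic G ω := fun z =>
    (comp_homeomorph_eventuallyEq (Homeomorph.addRight ω) continuous_id (.of_forall hω) (hFG z)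
      (hFG _) hG.continuous.continuousAt hG.continuous.continuousAt).eq_of_nhds
  exact ⟨G 0, fun z => (hFG z).trans (.of_forall fun w =>
    apply_eq_apply_of_doublyPeriodic L hG (periodic_G h₁) (periodic_G h₂) w 0)⟩

lemma exists_eq_const_mul_of_quasiPeriodic {f g u₁ u₂ : ℂ → ℂ} (hf : Differentiable ℂ f)
    (hg : Differentiable ℂ g) (hu₁ : ∀ z, u₁ z ≠ 0) (hu₂ : ∀ z, u₂ z ≠ 0)
    (hf₁ : ∀ z, f (z + L.ω₁) = u₁ z * f z) (hf₂ : ∀ z, f (z + L.ω₂) = u₂ z * f z)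
    (hg₁ : ∀ z, g (z + L.ω₁) = u₁ z * g z) (hg₂ : ∀ z, g (z + L.ω₂) = u₂ z * g z)
    (hzero : ∀ z, ∃ l ∈ L.lattice, g (z + l) = 0 → f (z + l) = 0 ∧ deriv g (z + l) ≠ 0) :
    ∃ κ, ∀ z, f z = κ * g z := by
  obtain ⟨κ, hκ⟩ := eventuallyEq_const_of_doublyPeriodic (F := f / g) L
    (fun z => (hf.analyticAt z).meromorphicAt.div (hg.analyticAt z).meromorphicAt)
    (fun z => by simp only [Pi.div_apply, hf₁, hg₁, mul_div_mul_left _ _ (hu₁ z)])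
    (fun z => by simp only [Pi.div_apply, hf₂, hg₂, mul_div_mul_left _ _ (hu₂ z)])
    (fun z => (hzero z).imp fun l hl =>
      ⟨hl.1, meromorphicOrderAt_div_nonneg (hf.analyticAt _) (hg.analyticAt _) hl.2⟩)
  obtain ⟨z₀, hz₀⟩ : ∃ z, g z ≠ 0 := by
    by_contra! hg0
    obtain ⟨l, -, hl⟩ := hzero 0
    exact (hl (hg0 _)).2 (by simp [show g = 0 from funext hg0])
  have hnear : ∀ᶠ z in 𝓝[≠] z₀, f z = κ * g z := by
    filter_upwards [hκ z₀, (hg.continuous.continuousAt.eventually_ne hz₀).filter_mono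
      nhdsWithin_le_nhds] with z hz hgz
    rwa [Pi.div_apply, div_eq_iff hgz] at hz
  have hgκ : Differentiable ℂ fun z => κ * g z := hg.const_mul κ
  exact ⟨κ, congrFun (AnalyticOnNhd.eq_of_frequently_eq (fun z _ => hf.analyticAt z)
    (fun z _ => hgκ.analyticAt z) hnear.frequently)⟩

end Liouville

section Theta

lemma integral_jacobiTheta₂ {τ : ℂ} (hτ : 0 < τ.im) :
    ∫ x in (0 : ℝ)..1, jacobiTheta₂ x τ = 1 := by
  have hterm (n : ℤ) : ∫ x in (0 : ℝ)..1, jacobiTheta₂_term n x τ = if n = 0 then 1 else 0 := by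
    split_ifs with hn
    · simp [jacobiTheta₂_term, hn]
    · have hc : 2 * π * I * n ≠ 0 := by simp [hn, pi_ne_zero]
      have hper : exp (2 * π * I * n) = 1 := by
        rw [mul_comm, Complex.exp_int_mul_two_pi_mul_I]
      simp only [jacobiTheta₂_term, Complex.exp_add, intervalIntegral.integral_mul_const]
      rw [integral_exp_mul_complex hc]
      simp [hper]
  have hsummable : Summable fun n : ℤ => ‖jacobiTheta₂_term n 0 τ‖ :=
    (summable_jacobiTheta₂_term_iff 0 τ).2 hτ |>.norm
  have hsum := intervalIntegral.hasSum_intervalIntegral_of_summable_norm (a := 0) (b := 1)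
    (f := fun n : ℤ => ⟨fun x : ℝ => jacobiTheta₂_term n x τ, by
      unfold jacobiTheta₂_term; fun_prop⟩) (by
      refine hsummable.of_nonneg_of_le (fun _ => norm_nonneg _) fun n => ?_
      refine (ContinuousMap.norm_le _ (norm_nonneg _)).2 fun x => ?_
      simp [norm_jacobiTheta₂_term])
  simp only [ContinuousMap.coe_mk, hterm] at hsum
  exact hsum.unique (hasSum_ite_eq 0 1)

variable {τ : ℂ}

/-- The quasi-periods `π` and `πτ` of `θ(· | τ)`. -/
noncomputable def thetaPeriods (hτ : 0 < τ.im) : PeriodPair where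
  ω₁ := π
  ω₂ := π * τ
  indep := by
    refine LinearIndependent.pair_iff.2 fun s t hst => ?_
    have ht : t = 0 := by simpa [pi_ne_zero, hτ.ne'] using congrArg Complex.im hst
    have hs : s = 0 := by simpa [ht, pi_ne_zero] using congrArg Complex.re hst
    exact ⟨hs, ht⟩

/-- The factor by which `θ(· | τ)` gets multiplied under translation by `πτ`. -/
noncomputable def thetaMultiplier (τ z : ℂ) : ℂ := -exp (-(I * π * τ)) * exp (-(2 * I * z))

lemma thetaMultiplier_ne_zero (τ z : ℂ) : thetaMultiplier τ z ≠ 0 :=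
  mul_ne_zero (neg_ne_zero.2 (Complex.exp_ne_zero _)) (Complex.exp_ne_zero _)

lemma exp_mul_jacobiTheta₂_term (τ z : ℂ) (m : ℤ) :
    exp (I * π * τ / 4 + I * z) * jacobiTheta₂_term m (z / π + 1 / 2 + τ / 2) τ =
      (-1) ^ m * exp (I * π * τ * (m + 1 / 2) ^ 2) * exp ((2 * m + 1) * I * z) := by
  have hsign : (-1 : ℂ) ^ m = exp (m * (π * I)) := by
    rw [Complex.exp_int_mul, Complex.exp_pi_mul_I]
  have hπ : (π : ℂ) ≠ 0 := Complex.ofReal_ne_zero.2 pi_ne_zero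
  rw [hsign, jacobiTheta₂_term]
  simp only [← Complex.exp_add]
  congr 1
  field

lemma theta_eq_jacobiTheta₂ (hτ : 0 < τ.im) (z : ℂ) :
    theta z τ = exp (I * π * τ / 4 + I * z) * jacobiTheta₂ (z / π + 1 / 2 + τ / 2) τ := by
  have h := (hasSum_jacobiTheta₂_term (z / π + 1 / 2 + τ / 2) hτ).mul_left
    (exp (I * π * τ / 4 + I * z))
  simp only [exp_mul_jacobiTheta₂_term] at h
  rw [← h.nat_add_neg_add_one.tsum_eq, theta]
  refine tsum_congr fun n => ?_
  have hsign : (-1 : ℂ) ^ (-((n : ℤ) + 1)) = -(-1) ^ n := by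
    rw [zpow_neg, ← inv_zpow, ← Nat.cast_succ, zpow_natCast, pow_succ]
    norm_num
  rw [hsign, zpow_natCast]
  push_cast
  rw [show (-((n : ℂ) + 1) + 1 / 2) ^ 2 = (n + 1 / 2) ^ 2 by ring,
    show (2 * -((n : ℂ) + 1) + 1) * I * z = -((2 * n + 1) * I * z) by ring]
  ring

lemma differentiable_theta (hτ : 0 < τ.im) : Differentiable ℂ fun z => theta z τ := by
  rw [funext (theta_eq_jacobiTheta₂ hτ)]
  have hJ : Differentiable ℂ fun w => jacobiTheta₂ w τ :=
    fun w => differentiableAt_jacobiTheta₂_fst w hτ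
  exact Differentiable.mul (by fun_prop)
    (hJ.comp (f := fun z : ℂ => z / π + 1 / 2 + τ / 2) (by fun_prop))

lemma exists_theta_ne_zero (hτ : 0 < τ.im) : ∃ z, theta z τ ≠ 0 := by
  by_contra! hzero
  have hπ : (π : ℂ) ≠ 0 := Complex.ofReal_ne_zero.2 pi_ne_zero
  have hJ (x : ℂ) : jacobiTheta₂ x τ = 0 := by
    have h := hzero (π * (x - 1 / 2 - τ / 2))
    rw [theta_eq_jacobiTheta₂ hτ, mul_div_cancel_left₀ _ hπ, sub_sub, add_assoc,
      sub_add_cancel] at h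
    exact (mul_eq_zero.1 h).resolve_left (Complex.exp_ne_zero _)
  simpa [hJ] using integral_jacobiTheta₂ hτ

@[simp]
lemma theta_neg (z τ : ℂ) : theta (-z) τ = -theta z τ := by
  rw [theta, theta, ← tsum_neg]
  exact tsum_congr fun n => by rw [mul_neg, neg_neg]; ring

@[simp]
lemma theta_zero (τ : ℂ) : theta 0 τ = 0 := by simp [theta]

lemma theta_add_pi (z τ : ℂ) : theta (z + π) τ = -theta z τ := by
  rw [theta, theta, ← tsum_neg]
  refine tsum_congr fun n => ?_
  have hexp : exp ((2 * n + 1) * I * π) = -1 := by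
    rw [show (2 * n + 1) * I * π = n * (2 * π * I) + π * I by ring, Complex.exp_add,
      Complex.exp_nat_mul_two_pi_mul_I, Complex.exp_pi_mul_I, one_mul]
  rw [mul_add, neg_add, Complex.exp_add, Complex.exp_add, Complex.exp_neg (_ * (π : ℂ)), hexp]
  norm_num
  ring

lemma theta_add_pi_mul (hτ : 0 < τ.im) (z : ℂ) :
    theta (z + π * τ) τ = thetaMultiplier τ z * theta z τ := by
  have hπ : (π : ℂ) ≠ 0 := Complex.ofReal_ne_zero.2 pi_ne_zero
  have hneg : (-1 : ℂ) = exp (-(π * I)) := by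
    rw [Complex.exp_neg, Complex.exp_pi_mul_I, inv_neg_one]
  rw [theta_eq_jacobiTheta₂ hτ, theta_eq_jacobiTheta₂ hτ, thetaMultiplier,
    show (z + π * τ) / π + 1 / 2 + τ / 2 = (z / π + 1 / 2 + τ / 2) + τ by field,
    jacobiTheta₂_add_left', neg_eq_neg_one_mul (exp (-(I * π * τ))), hneg]
  simp only [← mul_assoc, ← Complex.exp_add]
  congr 2
  field

lemma theta_eq_zero_of_mem_lattice (hτ : 0 < τ.im) {z : ℂ} (hz : z ∈ (thetaPeriods hτ).lattice) :
    theta z τ = 0 := by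
  have hper : Function.Periodic (fun w => theta w τ = 0) z :=
    periodic_of_mem_lattice (L := thetaPeriods hτ)
      (fun w => by simp [thetaPeriods, theta_add_pi])
      (fun w => by simp [thetaPeriods, theta_add_pi_mul hτ, thetaMultiplier_ne_zero]) hz
  simpa using hper 0

lemma theta_conj (hre : τ.re = 0) (z : ℂ) :
    starRingEnd ℂ (theta z τ) = -theta (starRingEnd ℂ z) τ := by
  have hτ_conj : starRingEnd ℂ τ = -τ := by
    apply Complex.ext <;> simp [hre]
  rw [theta, theta, Complex.conj_tsum, ← tsum_neg]
  refine tsum_congr fun n => ?_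
  simp only [map_mul, map_sub, map_pow, map_neg, map_one, ← Complex.exp_conj, Complex.conj_I,
    Complex.conj_ofReal, hτ_conj, map_add, map_div₀, map_natCast, map_ofNat]
  ring_nf

end Theta

section InfiniteProduct

variable {p : ℂ}

/-- The infinite `q`-Pochhammer symbol `(w; p)_∞ = ∏_{n ≥ 0} (1 - p ^ n w)`. -/
noncomputable def qProduct (p w : ℂ) : ℂ := ∏' n : ℕ, (1 + -(p ^ n * w))

lemma summable_norm_pow_mul (hp : ‖p‖ < 1) (w : ℂ) : Summable fun n : ℕ => ‖-(p ^ n * w)‖ := by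
  simpa using (summable_geometric_of_lt_one (norm_nonneg p) hp).mul_right ‖w‖

lemma qProduct_eq_one_sub_mul (hp : ‖p‖ < 1) (w : ℂ) :
    qProduct p w = (1 - w) * qProduct p (p * w) := by
  have hshift : (fun n : ℕ => 1 + -(p ^ (n + 1) * w)) = fun n => 1 + -(p ^ n * (p * w)) := by
    funext n
    ring
  have hm : Multipliable fun n : ℕ => 1 + -(p ^ (n + 1) * w) := by
    rw [hshift]
    exact multipliable_one_add_of_summable (summable_norm_pow_mul hp (p * w))
  have h := tprod_eq_zero_mul' (f := fun n : ℕ => 1 + -(p ^ n * w)) hm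
  rwa [hshift, pow_zero, one_mul, ← sub_eq_add_neg] at h

lemma qProduct_ne_zero {w : ℂ} (hp : ‖p‖ < 1) (hw : ∀ n : ℕ, p ^ n * w ≠ 1) :
    qProduct p w ≠ 0 :=
  tprod_one_add_ne_zero_of_summable (fun n h => hw n (by linear_combination -h))
    (summable_norm_pow_mul hp w)

lemma differentiable_qProduct (hp : ‖p‖ < 1) : Differentiable ℂ (qProduct p) := by
  have h : HasProdLocallyUniformlyOn (fun (n : ℕ) w => 1 + -(p ^ n * w)) (qProduct p) univ := by
    refine hasProdLocallyUniformlyOn_of_forall_compact isOpen_univ fun K _ hK => ?_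
    obtain ⟨R, hR⟩ := hK.isBounded.exists_norm_le
    refine ((summable_geometric_of_lt_one (norm_nonneg p) hp).mul_right R
      ).hasProdUniformlyOn_nat_one_add hK (.of_forall fun n x hx => ?_) fun _ => by fun_prop
    simpa using mul_le_mul_of_nonneg_left (hR x hx) (by positivity)
  rw [← differentiableOn_univ]
  refine h.differentiableOn (.of_forall fun s => ?_) isOpen_univ
  simpa only [Finset.prod_fn] using
    DifferentiableOn.fun_finsetProd (u := s) fun _ _ => by fun_prop

end InfiniteProduct

section ThetaZeros

variable {τ : ℂ}

/-- The product `e^{-iz} ∏_{n ≥ 0} (1 - q^{2n} e^{2iz}) (1 - q^{2n+2} e^{-2iz})` with nome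
`q = e^{iπτ}`; by the Jacobi triple product identity it is `θ(z | τ)` up to a constant. -/
noncomputable def thetaProd (z τ : ℂ) : ℂ :=
  exp (-(I * z)) * (qProduct (exp (2 * I * (π * τ))) (exp (2 * I * z)) *
    qProduct (exp (2 * I * (π * τ))) (exp (2 * I * (π * τ - z))))

lemma norm_exp_two_pi_mul_lt_one (hτ : 0 < τ.im) : ‖exp (2 * I * (π * τ))‖ < 1 := by
  have hpos : 0 < 2 * (π * τ.im) := by positivity
  rw [Complex.norm_exp, Real.exp_lt_one_iff]
  simpa using hpos

lemma differentiable_thetaProd (hτ : 0 < τ.im) : Differentiable ℂ fun z => thetaProd z τ := by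
  have h := differentiable_qProduct (norm_exp_two_pi_mul_lt_one hτ)
  exact Differentiable.mul (by fun_prop) (Differentiable.mul
    (h.comp (f := fun z => exp (2 * I * z)) (by fun_prop))
    (h.comp (f := fun z => exp (2 * I * (π * τ - z))) (by fun_prop)))

lemma thetaProd_add_pi (z τ : ℂ) : thetaProd (z + π) τ = -thetaProd z τ := by
  have hπ : exp (2 * I * π) = 1 := by
    rw [show 2 * I * π = 2 * π * I by ring, Complex.exp_two_pi_mul_I]
  have hneg : exp (-(I * (z + π))) = -exp (-(I * z)) := by
    rw [mul_add, neg_add, Complex.exp_add, Complex.exp_neg (I * π), mul_comm I (π : ℂ),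
      Complex.exp_pi_mul_I, inv_neg_one, mul_neg_one]
  have hplus : exp (2 * I * (z + π)) = exp (2 * I * z) := by
    rw [mul_add, Complex.exp_add, hπ, mul_one]
  have hminus : exp (2 * I * (π * τ - (z + π))) = exp (2 * I * (π * τ - z)) := by
    rw [← sub_sub, mul_sub, Complex.exp_sub, hπ, div_one]
  rw [thetaProd, thetaProd, hneg, hplus, hminus, neg_mul]

lemma thetaProd_add_pi_mul (hτ : 0 < τ.im) (z : ℂ) :
    thetaProd (z + π * τ) τ = thetaMultiplier τ z * thetaProd z τ := by
  have hp := norm_exp_two_pi_mul_lt_one hτ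
  set p := exp (2 * I * (π * τ)) with hp_def
  have hplus : exp (2 * I * (z + π * τ)) = p * exp (2 * I * z) := by
    rw [← Complex.exp_add]; ring_nf
  have hminus : exp (2 * I * (π * τ - z)) = p * exp (-(2 * I * z)) := by
    rw [← Complex.exp_add]; ring_nf
  have hminus' : exp (2 * I * (π * τ - (z + π * τ))) = exp (-(2 * I * z)) := by ring_nf
  have hneg : exp (-(I * (z + π * τ))) = exp (-(I * π * τ)) * exp (-(I * z)) := by
    rw [← Complex.exp_add]; ring_nf
  have hinv : exp (-(2 * I * z)) * exp (2 * I * z) = 1 := by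
    rw [← Complex.exp_add, neg_add_cancel, Complex.exp_zero]
  rw [thetaProd, thetaProd, thetaMultiplier, ← hp_def, hplus, hminus, hminus', hneg,
    qProduct_eq_one_sub_mul hp (exp (2 * I * z)), qProduct_eq_one_sub_mul hp (exp (-(2 * I * z)))]
  linear_combination (-exp (-(I * π * τ)) * exp (-(I * z)) * qProduct p (p * exp (2 * I * z)) *
    qProduct p (p * exp (-(2 * I * z)))) * hinv

lemma mem_lattice_of_qProduct_eq_zero (hτ : 0 < τ.im) {w : ℂ}
    (hw : qProduct (exp (2 * I * (π * τ))) (exp (2 * I * w)) = 0) :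
    w ∈ (thetaPeriods hτ).lattice := by
  by_contra hmem
  refine qProduct_ne_zero (norm_exp_two_pi_mul_lt_one hτ) (fun n hn => hmem ?_) hw
  rw [← Complex.exp_nat_mul, ← Complex.exp_add, Complex.exp_eq_one_iff] at hn
  obtain ⟨k, hk⟩ := hn
  refine PeriodPair.mem_lattice.2 ⟨k, -n, ?_⟩
  refine mul_left_cancel₀ (mul_ne_zero two_ne_zero Complex.I_ne_zero) ?_
  simp only [thetaPeriods, Int.cast_neg, Int.cast_natCast]
  linear_combination -hk

lemma mem_lattice_of_thetaProd_eq_zero (hτ : 0 < τ.im) {z : ℂ} (hz : thetaProd z τ = 0) :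
    z ∈ (thetaPeriods hτ).lattice := by
  rw [thetaProd, mul_eq_zero, or_iff_right (Complex.exp_ne_zero _)] at hz
  rcases mul_eq_zero.1 hz with h | h
  · exact mem_lattice_of_qProduct_eq_zero hτ h
  · have hω := (thetaPeriods hτ).ω₂_mem_lattice
    simpa [thetaPeriods] using sub_mem hω (mem_lattice_of_qProduct_eq_zero hτ h)

lemma deriv_thetaProd_zero_ne_zero (hτ : 0 < τ.im) : deriv (fun z => thetaProd z τ) 0 ≠ 0 := by
  have hp := norm_exp_two_pi_mul_lt_one hτ
  set p := exp (2 * I * (π * τ)) with hp_def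
  have hq := differentiable_qProduct hp
  let g (z : ℂ) : ℂ :=
    exp (-(I * z)) * (qProduct p (p * exp (2 * I * z)) * qProduct p (exp (2 * I * (π * τ - z))))
  have hg : Differentiable ℂ g :=
    Differentiable.mul (by fun_prop) (Differentiable.mul
      (hq.comp (f := fun z => p * exp (2 * I * z)) (by fun_prop))
      (hq.comp (f := fun z => exp (2 * I * (π * τ - z))) (by fun_prop)))
  have hfactor : (fun z => thetaProd z τ) = fun z => (1 - exp (2 * I * z)) * g z := by
    funext z
    rw [thetaProd, ← hp_def, qProduct_eq_one_sub_mul hp (exp (2 * I * z))]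
    ring
  have hg0 : g 0 ≠ 0 := by
    have hpp : qProduct p p ≠ 0 := qProduct_ne_zero hp fun n hn => by
      have hlt := pow_lt_one₀ (norm_nonneg p) hp n.succ_ne_zero
      rw [← norm_pow, pow_succ, hn, norm_one] at hlt
      exact lt_irrefl _ hlt
    simpa [g, ← hp_def] using hpp
  have hderiv : HasDerivAt (fun z => 1 - exp (2 * I * z)) (-(2 * I)) 0 := by
    simpa using ((hasDerivAt_id (0 : ℂ)).const_mul (2 * I)).cexp.const_sub 1
  rw [hfactor, (hderiv.fun_mul (hg 0).hasDerivAt).deriv]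
  simpa using hg0

lemma exists_theta_eq_mul_thetaProd (hτ : 0 < τ.im) :
    ∃ κ : ℂ, κ ≠ 0 ∧ ∀ z, theta z τ = κ * thetaProd z τ := by
  obtain ⟨κ, hκ⟩ := exists_eq_const_mul_of_quasiPeriodic (thetaPeriods hτ) (u₁ := fun _ => -1)
    (differentiable_theta hτ) (differentiable_thetaProd hτ) (by simp) (thetaMultiplier_ne_zero τ)
    (fun z => by rw [neg_one_mul]; exact theta_add_pi z τ) (theta_add_pi_mul hτ)
    (fun z => by rw [neg_one_mul]; exact thetaProd_add_pi z τ) (thetaProd_add_pi_mul hτ)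
    fun z => by
      by_cases hz : z ∈ (thetaPeriods hτ).lattice
      · refine ⟨-z, neg_mem hz, fun _ => ?_⟩
        rw [add_neg_cancel]
        exact ⟨theta_zero τ, deriv_thetaProd_zero_ne_zero hτ⟩
      · refine ⟨0, zero_mem _, fun h => absurd ?_ hz⟩
        rw [add_zero] at h
        exact mem_lattice_of_thetaProd_eq_zero hτ h
  obtain ⟨z, hz⟩ := exists_theta_ne_zero hτ
  exact ⟨κ, left_ne_zero_of_mul (hκ z ▸ hz), hκ⟩

lemma theta_eq_zero_iff (hτ : 0 < τ.im) {z : ℂ} :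
    theta z τ = 0 ↔ z ∈ (thetaPeriods hτ).lattice := by
  refine ⟨fun hz => ?_, theta_eq_zero_of_mem_lattice hτ⟩
  obtain ⟨κ, hκ, h⟩ := exists_theta_eq_mul_thetaProd hτ
  rw [h, mul_eq_zero, or_iff_right hκ] at hz
  exact mem_lattice_of_thetaProd_eq_zero hτ hz

lemma theta'_zero_ne_zero (hτ : 0 < τ.im) : theta' 0 τ ≠ 0 := by
  obtain ⟨κ, hκ, h⟩ := exists_theta_eq_mul_thetaProd hτ
  rw [theta', funext h, deriv_const_mul_field]
  exact mul_ne_zero hκ (deriv_thetaProd_zero_ne_zero hτ)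

lemma theta_ne_zero_of_im (hτ : 0 < τ.im) (n : ℤ) {z : ℂ} (h₁ : n * (π * τ.im) < z.im)
    (h₂ : z.im < (n + 1) * (π * τ.im)) : theta z τ ≠ 0 := by
  rw [Ne, theta_eq_zero_iff hτ, PeriodPair.mem_lattice]
  rintro ⟨m, k, rfl⟩
  have him : (m * (π : ℂ) + k * (π * τ)).im = k * (π * τ.im) := by simp
  rw [thetaPeriods, him] at h₁ h₂
  have hpos : 0 < π * τ.im := mul_pos pi_pos hτ
  have hn := lt_of_mul_lt_mul_right h₁ hpos.le
  have hn' := lt_of_mul_lt_mul_right h₂ hpos.le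
  norm_cast at hn hn'
  lia

lemma theta_pi_div_two_ne_zero (hτ : 0 < τ.im) : theta (π / 2) τ ≠ 0 := by
  rw [Ne, theta_eq_zero_iff hτ, PeriodPair.mem_lattice]
  rintro ⟨m, n, hmn⟩
  have hn : n = 0 := by simpa [thetaPeriods, pi_ne_zero, hτ.ne'] using congrArg Complex.im hmn
  have hπ : (π : ℂ) ≠ 0 := Complex.ofReal_ne_zero.2 pi_ne_zero
  have hm : (m * 2 : ℂ) = 1 := by
    refine mul_left_cancel₀ hπ ?_
    simp only [thetaPeriods, hn, Int.cast_zero, zero_mul, add_zero] at hmn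
    linear_combination 2 * hmn
  norm_cast at hm
  lia

lemma theta_add_ne_zero (hτ : 0 < τ.im) {z w : ℂ} (hz : theta z τ = 0) (hw : theta w τ ≠ 0) :
    theta (z + w) τ ≠ 0 := by
  rw [Ne, theta_eq_zero_iff hτ] at hw ⊢
  exact fun h => hw ((add_mem_cancel_left ((theta_eq_zero_iff hτ).1 hz)).1 h)

end ThetaZeros

section GeneratingFunction

/-- The walks of length `n` that stay in the quadrant, with arbitrary end point. -/
def quadrantWalks (n : ℕ) : Finset (Fin n → ℤ × ℤ) :=
  {w ∈ Fintype.piFinset fun _ : Fin n => steps |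
    ∀ k : Fin (n + 1), 0 ≤ (position w k).1 ∧ 0 ≤ (position w k).2}

/-- The weight of a walk: the product of the weights of its steps. -/
def walkWeight (a : ℝ) {n : ℕ} (w : Fin n → ℤ × ℤ) : ℝ := ∏ m, stepWeight a (w m)

/-- The generating polynomial `∑_{i,j} q(i, j; n) x^i y^j` of the quadrant walks of length `n`. -/
noncomputable def walkPoly (a : ℝ) (n : ℕ) (x y : ℂ) : ℂ :=
  ∑ w ∈ quadrantWalks n,
    (walkWeight a w : ℂ) * (x ^ (position w n).1.toNat * y ^ (position w n).2.toNat)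

/-- The Laurent polynomial `S(x, y)` of the weighted steps: the functional equation of `Q` has
kernel `1 - t S(x, y)`. -/
noncomputable def stepPoly (a : ℝ) (x y : ℂ) : ℂ := x + y + 1 / x + 1 / y + a * x * y

lemma walks_eq_filter (i j n : ℕ) : walks i j n =
    {w ∈ quadrantWalks n | j = (position w n).2.toNat ∧ i = (position w n).1.toNat} := by
  ext w
  simp only [walks, quadrantWalks, Finset.mem_filter, and_assoc]
  refine and_congr_right fun _ => and_congr_right fun h => ?_
  have hlast := h (Fin.last n)
  simp only [Fin.val_last] at hlast
  simp only [Prod.ext_iff]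
  lia

lemma walkCount_mul_monomial (a : ℝ) (i j n : ℕ) (x y s : ℂ) :
    (walkCount a i j n : ℂ) * x ^ i * y ^ j * s = ∑ w ∈ quadrantWalks n,
      if j = (position w n).2.toNat then if i = (position w n).1.toNat then
        walkWeight a w * (x ^ (position w n).1.toNat * y ^ (position w n).2.toNat) * s
      else 0 else 0 := by
  simp only [walkCount, walks_eq_filter, Complex.ofReal_sum, Finset.sum_mul, ← ite_and,
    ← Finset.sum_filter, walkWeight]
  refine Finset.sum_congr rfl fun w hw => ?_
  obtain ⟨-, rfl, rfl⟩ := Finset.mem_filter.1 hw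
  ring

lemma tsum_walkCount (a : ℝ) (n : ℕ) (x y s : ℂ) :
    ∑' i : ℕ, ∑' j : ℕ, (walkCount a i j n : ℂ) * x ^ i * y ^ j * s = walkPoly a n x y * s := by
  simp_rw [walkCount_mul_monomial, walkPoly, Finset.sum_mul,
    (hasSum_sum fun _ _ => hasSum_ite_eq _ _).tsum_eq]

lemma Q_eq_tsum (a t : ℝ) (x y : ℂ) :
    Q a t x y = ∑' n : ℕ, walkPoly a n x y * (t : ℂ) ^ n :=
  tsum_congr fun n => tsum_walkCount a n x y _

lemma position_snoc_of_le {n : ℕ} (w : Fin n → ℤ × ℤ) (s : ℤ × ℤ) {k : ℕ} (hk : k ≤ n) :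
    position (Fin.snoc w s : Fin (n + 1) → ℤ × ℤ) k = position w k := by
  rw [position, position, Finset.sum_filter, Finset.sum_filter, Fin.sum_univ_castSucc]
  simp [hk.not_gt]

lemma position_snoc_last {n : ℕ} (w : Fin n → ℤ × ℤ) (s : ℤ × ℤ) :
    position (Fin.snoc w s : Fin (n + 1) → ℤ × ℤ) (n + 1) = position w n + s := by
  simp [position, Finset.sum_filter, Fin.sum_univ_castSucc]

lemma walkWeight_snoc (a : ℝ) {n : ℕ} (w : Fin n → ℤ × ℤ) (s : ℤ × ℤ) :
    walkWeight a (Fin.snoc w s : Fin (n + 1) → ℤ × ℤ) = walkWeight a w * stepWeight a s := by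
  simp [walkWeight, Fin.prod_univ_castSucc]

lemma snoc_mem_quadrantWalks {n : ℕ} {w : Fin n → ℤ × ℤ} {s : ℤ × ℤ} :
    (Fin.snoc w s : Fin (n + 1) → ℤ × ℤ) ∈ quadrantWalks (n + 1) ↔ w ∈ quadrantWalks n ∧
      s ∈ steps ∧ 0 ≤ (position w n + s).1 ∧ 0 ≤ (position w n + s).2 := by
  have hposition (k : Fin (n + 1)) :
      position (Fin.snoc w s : Fin (n + 1) → ℤ × ℤ) k = position w k :=
    position_snoc_of_le w s (Nat.lt_succ_iff.1 k.isLt)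
  simp only [quadrantWalks, Finset.mem_filter, Fintype.mem_piFinset]
  rw [Fin.forall_fin_succ', Fin.forall_fin_succ' (n := n + 1)]
  simp only [Fin.snoc_castSucc, Fin.snoc_last, Fin.val_castSucc, Fin.val_last, hposition,
    position_snoc_last]
  tauto

lemma sum_quadrantWalks_succ {n : ℕ} (f : (Fin (n + 1) → ℤ × ℤ) → ℂ) :
    ∑ w ∈ quadrantWalks (n + 1), f w = ∑ w ∈ quadrantWalks n, ∑ s ∈ steps,
      if 0 ≤ (position w n + s).1 ∧ 0 ≤ (position w n + s).2 then f (Fin.snoc w s) else 0 := by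
  rw [← Finset.sum_product', ← Finset.sum_filter]
  refine Finset.sum_bij' (fun w _ => (Fin.init w, w (Fin.last n))) (fun p _ => Fin.snoc p.1 p.2)
    (fun w hw => ?_) (fun p hp => ?_) (fun w _ => Fin.snoc_init_self w) (by simp) (by simp)
  · rw [← Fin.snoc_init_self w, snoc_mem_quadrantWalks] at hw
    simp only [Finset.mem_filter, Finset.mem_product]
    tauto
  · simp only [Finset.mem_filter, Finset.mem_product] at hp
    rw [snoc_mem_quadrantWalks]
    tauto

lemma walkPoly_zero (a : ℝ) (x y : ℂ) : walkPoly a 0 x y = 1 := by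
  have huniv : quadrantWalks 0 = Finset.univ := by
    ext w
    simp [quadrantWalks, position]
  simp [walkPoly, walkWeight, huniv, position]

lemma sum_steps {M : Type*} [AddCommMonoid M] (f : ℤ × ℤ → M) :
    ∑ s ∈ steps, f s = f (0, 1) + f (1, 0) + f (0, -1) + f (-1, 0) + f (1, 1) := by
  simp [steps, add_assoc]

-- The terms `0 ^ i` and `0 ^ j` account for the steps that leave the quadrant.
lemma sum_steps_monomial (a : ℝ) (i j : ℕ) {x y : ℂ} (hx : x ≠ 0) (hy : y ≠ 0) :
    (∑ s ∈ steps, if 0 ≤ i + s.1 ∧ 0 ≤ j + s.2 then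
      (stepWeight a s : ℂ) * (x ^ (i + s.1).toNat * y ^ (j + s.2).toNat) else 0) =
      stepPoly a x y * (x ^ i * y ^ j) - 0 ^ i * y ^ j / x - x ^ i * 0 ^ j / y := by
  have hi : ((i : ℤ) + 1).toNat = i + 1 := by lia
  have hj : ((j : ℤ) + 1).toNat = j + 1 := by lia
  have hi0 : 0 ≤ (i : ℤ) + 1 := by lia
  have hj0 : 0 ≤ (j : ℤ) + 1 := by lia
  simp only [sum_steps, stepWeight, stepPoly, add_zero, hi, hj, hi0, hj0, Int.toNat_natCast,
    Int.natCast_nonneg, true_and, and_true, if_true]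
  rcases i with _ | i <;> rcases j with _ | j <;> simp <;> field_simp <;> ring

lemma walkPoly_succ (a : ℝ) (n : ℕ) {x y : ℂ} (hx : x ≠ 0) (hy : y ≠ 0) :
    walkPoly a (n + 1) x y = stepPoly a x y * walkPoly a n x y -
      walkPoly a n 0 y / x - walkPoly a n x 0 / y := by
  rw [walkPoly, sum_quadrantWalks_succ]
  simp only [walkPoly, Finset.mul_sum, Finset.sum_div, ← Finset.sum_sub_distrib]
  refine Finset.sum_congr rfl fun w hw => ?_
  have hnonneg := (Finset.mem_filter.1 hw).2 (Fin.last n)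
  simp only [Fin.val_last] at hnonneg
  obtain ⟨i, hi⟩ := Int.eq_ofNat_of_zero_le hnonneg.1
  obtain ⟨j, hj⟩ := Int.eq_ofNat_of_zero_le hnonneg.2
  have hsum := congrArg ((walkWeight a w : ℂ) * ·) (sum_steps_monomial a i j hx hy)
  simp only [Finset.mul_sum, mul_ite, mul_zero] at hsum
  simp only [walkWeight_snoc, position_snoc_last, Complex.ofReal_mul, mul_assoc, Prod.fst_add,
    Prod.snd_add, hi, hj, Int.toNat_natCast, hsum]
  ring

lemma abs_stepWeight (a : ℝ) (s : ℤ × ℤ) : |stepWeight a s| = stepWeight |a| s := by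
  unfold stepWeight
  split_ifs <;> simp

lemma abs_walkWeight (a : ℝ) {n : ℕ} (w : Fin n → ℤ × ℤ) : |walkWeight a w| = walkWeight |a| w := by
  simp only [walkWeight, Finset.abs_prod, abs_stepWeight]

lemma sum_piFinset_walkWeight (a : ℝ) (n : ℕ) :
    ∑ w ∈ Fintype.piFinset fun _ : Fin n => steps, walkWeight a w = (a + 4) ^ n := by
  have hsum : ∑ s ∈ steps, stepWeight a s = a + 4 := by
    norm_num [sum_steps, stepWeight, add_comm]
  simp only [walkWeight, ← Finset.prod_univ_sum, hsum, Fin.prod_const]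

lemma norm_walkPoly_le (a : ℝ) (n : ℕ) {x y : ℂ} (hx : ‖x‖ ≤ 1) (hy : ‖y‖ ≤ 1) :
    ‖walkPoly a n x y‖ ≤ (|a| + 4) ^ n := by
  calc ‖walkPoly a n x y‖ ≤ ∑ w ∈ quadrantWalks n, |walkWeight a w| := by
        refine norm_sum_le_of_le _ fun w _ => ?_
        rw [norm_mul, Complex.norm_real, Real.norm_eq_abs, norm_mul, norm_pow, norm_pow]
        exact mul_le_of_le_one_right (abs_nonneg _) (mul_le_one₀ (pow_le_one₀ (norm_nonneg _) hx)
          (by positivity) (pow_le_one₀ (norm_nonneg _) hy))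
    _ ≤ ∑ w ∈ Fintype.piFinset fun _ : Fin n => steps, |walkWeight a w| :=
        Finset.sum_le_sum_of_subset_of_nonneg (Finset.filter_subset _ _) fun _ _ _ => abs_nonneg _
    _ = (|a| + 4) ^ n := by simp only [abs_walkWeight, sum_piFinset_walkWeight]

lemma position_swap {n : ℕ} (w : Fin n → ℤ × ℤ) (k : ℕ) :
    position (fun m => (w m).swap) k = (position w k).swap := by
  apply Prod.ext <;> simp [position, Prod.fst_sum, Prod.snd_sum]

lemma swap_mem_steps {s : ℤ × ℤ} : s.swap ∈ steps ↔ s ∈ steps := by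
  obtain ⟨i, j⟩ := s
  simp only [steps, Finset.mem_insert, Finset.mem_singleton, Prod.swap_prod_mk, Prod.mk.injEq]
  lia

lemma swap_mem_quadrantWalks {n : ℕ} {w : Fin n → ℤ × ℤ} :
    (fun m => (w m).swap) ∈ quadrantWalks n ↔ w ∈ quadrantWalks n := by
  simp only [quadrantWalks, Finset.mem_filter, Fintype.mem_piFinset, swap_mem_steps, position_swap,
    Prod.fst_swap, Prod.snd_swap, and_comm]

lemma walkWeight_swap (a : ℝ) {n : ℕ} (w : Fin n → ℤ × ℤ) :
    walkWeight a (fun m => (w m).swap) = walkWeight a w := by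
  simp only [walkWeight, stepWeight, Prod.ext_iff, Prod.fst_swap, Prod.snd_swap, and_comm]

lemma walkPoly_swap (a : ℝ) (n : ℕ) (x y : ℂ) : walkPoly a n x y = walkPoly a n y x := by
  refine Finset.sum_bij' (fun w _ m => (w m).swap) (fun w _ m => (w m).swap)
    (fun w => swap_mem_quadrantWalks.2) (fun w => swap_mem_quadrantWalks.2) (by simp) (by simp)
    fun w _ => ?_
  rw [position_swap, walkWeight_swap, Prod.fst_swap, Prod.snd_swap, mul_comm (x ^ _)]

lemma Q_swap (a t : ℝ) (x y : ℂ) : Q a t x y = Q a t y x := by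
  simp only [Q_eq_tsum, walkPoly_swap a _ x y]

variable {a t : ℝ}

lemma norm_walkPoly_mul_pow_le (n : ℕ) {x y : ℂ} (hx : ‖x‖ ≤ 1) (hy : ‖y‖ ≤ 1) :
    ‖walkPoly a n x y * (t : ℂ) ^ n‖ ≤ ((|a| + 4) * |t|) ^ n := by
  rw [norm_mul, norm_pow, Complex.norm_real, Real.norm_eq_abs, mul_pow]
  exact mul_le_mul_of_nonneg_right (norm_walkPoly_le a n hx hy) (by positivity)

lemma hasSum_Q (hat : (|a| + 4) * |t| < 1) {x y : ℂ} (hx : ‖x‖ ≤ 1) (hy : ‖y‖ ≤ 1) :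
    HasSum (fun n : ℕ => walkPoly a n x y * (t : ℂ) ^ n) (Q a t x y) := by
  rw [Q_eq_tsum]
  exact (Summable.of_norm_bounded (summable_geometric_of_lt_one (by positivity) hat) fun n =>
    norm_walkPoly_mul_pow_le n hx hy).hasSum

lemma Q_functional_equation (hat : (|a| + 4) * |t| < 1) {x y : ℂ} (hx : ‖x‖ ≤ 1) (hy : ‖y‖ ≤ 1)
    (hx0 : x ≠ 0) (hy0 : y ≠ 0) :
    Q a t x y = 1 + t * stepPoly a x y * Q a t x y - t / x * Q a t 0 y - t / y * Q a t x 0 := by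
  have hQ := hasSum_Q hat hx hy
  have hsucc : HasSum (fun n : ℕ => walkPoly a (n + 1) x y * (t : ℂ) ^ (n + 1))
      (t * stepPoly a x y * Q a t x y - t / x * Q a t 0 y - t / y * Q a t x 0) := by
    have hQ₀y := hasSum_Q hat (norm_zero.trans_le zero_le_one) hy
    have hQx₀ := hasSum_Q hat hx (norm_zero.trans_le zero_le_one)
    refine (((hQ.mul_left _).sub (hQ₀y.mul_left _)).sub (hQx₀.mul_left _)).congr_fun fun n => ?_
    rw [walkPoly_succ a n hx0 hy0]
    ring
  have h := hQ.unique ((hasSum_nat_add_iff 1).1 hsucc)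
  rw [Finset.sum_range_one, walkPoly_zero] at h
  linear_combination h

lemma Q_add_Q_eq_of_kernel (ht : t ≠ 0) (hat : (|a| + 4) * |t| < 1) {x y : ℂ} (hx : ‖x‖ ≤ 1)
    (hy : ‖y‖ ≤ 1) (hx0 : x ≠ 0) (hy0 : y ≠ 0) (hkernel : stepPoly a x y = 1 / t) :
    t * x * Q a t x 0 + t * y * Q a t 0 y = x * y := by
  have ht0 : (t : ℂ) ≠ 0 := Complex.ofReal_ne_zero.2 ht
  have h := Q_functional_equation hat hx hy hx0 hy0
  rw [hkernel] at h
  field_simp at h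
  linear_combination h

lemma differentiableOn_Q (hat : (|a| + 4) * |t| < 1) :
    DifferentiableOn ℂ (fun x => Q a t x 0) (Metric.ball 0 1) := by
  simp_rw [Q_eq_tsum]
  refine Complex.differentiableOn_tsum_of_summable_norm
    (summable_geometric_of_lt_one (by positivity) hat) (fun n => ?_) Metric.isOpen_ball
    fun n x hx => norm_walkPoly_mul_pow_le n (mem_ball_zero_iff.1 hx).le (by simp)
  unfold walkPoly
  fun_prop

end GeneratingFunction

section ThetaShifts

variable {τ : ℂ}

lemma theta'_neg (z τ : ℂ) : theta' (-z) τ = theta' z τ := by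
  have h := deriv_comp_neg (fun w => theta w τ) z
  simp only [theta_neg, deriv.fun_neg] at h
  exact (neg_injective h).symm

lemma hasDerivAt_theta_add (hτ : 0 < τ.im) (s z : ℂ) :
    HasDerivAt (fun z => theta (z + s) τ) (theta' (z + s) τ) z :=
  (differentiable_theta hτ (z + s)).hasDerivAt.comp_add_const z s

@[fun_prop]
lemma differentiable_theta_comp {f : ℂ → ℂ} (hτ : 0 < τ.im) (hf : Differentiable ℂ f) :
    Differentiable ℂ fun z => theta (f z) τ :=
  (differentiable_theta hτ).comp hf

lemma theta_add_pi_add (z w τ : ℂ) : theta (z + π + w) τ = -theta (z + w) τ := by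
  rw [add_right_comm, theta_add_pi]

lemma theta_add_pi_mul_add (hτ : 0 < τ.im) (z w : ℂ) :
    theta (z + π * τ + w) τ = thetaMultiplier τ z * exp (-(2 * I * w)) * theta (z + w) τ := by
  rw [add_right_comm, theta_add_pi_mul hτ, thetaMultiplier, thetaMultiplier, mul_add, neg_add,
    Complex.exp_add, ← mul_assoc (-exp _)]

end ThetaShifts

section Uniformization

variable {c γ τ : ℂ}

lemma Y_eq_X_neg (c γ τ z : ℂ) : Y c γ τ z = X c γ τ (-z) := by
  rw [X, Y, show -z + γ = -(z - γ) by ring, show -z - γ = -(z + γ) by ring,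
    show -z + 2 * γ = -(z - 2 * γ) by ring]
  simp only [theta_neg, neg_mul_neg]

lemma X_neg_gamma_sub (c γ τ z : ℂ) : X c γ τ (-γ - z) = X c γ τ z := by
  rw [X, X, show -γ - z = -(z + γ) by ring, show -(z + γ) + γ = -z by ring,
    show -(z + γ) - γ = -(z + 2 * γ) by ring, show -(z + γ) + 2 * γ = -(z - γ) by ring]
  simp only [theta_neg, neg_mul_neg]
  rw [mul_comm (theta (z + γ) τ), mul_comm (theta (z + 2 * γ) τ)]

lemma periodic_X_pi (c γ τ : ℂ) : Function.Periodic (X c γ τ) π := fun z => by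
  simp only [X, sub_eq_add_neg, theta_add_pi_add, theta_add_pi, neg_mul_neg]

lemma periodic_X_pi_mul (c γ : ℂ) (hτ : 0 < τ.im) : Function.Periodic (X c γ τ) (π * τ) :=
  fun z => by
  have hexp : exp (-(2 * I * -γ)) * exp (-(2 * I * (2 * γ))) = exp (-(2 * I * γ)) := by
    rw [← Complex.exp_add]
    ring_nf
  have hμ : thetaMultiplier τ z ^ 2 * exp (-(2 * I * γ)) ≠ 0 :=
    mul_ne_zero (pow_ne_zero 2 (thetaMultiplier_ne_zero τ z)) (Complex.exp_ne_zero _)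
  simp only [X, sub_eq_add_neg, theta_add_pi_mul_add hτ, theta_add_pi_mul hτ]
  rw [← mul_div_mul_left (theta z τ * theta (z + γ) τ) _ hμ]
  congr 2
  · ring
  · linear_combination
      (thetaMultiplier τ z ^ 2 * theta (z + -γ) τ * theta (z + 2 * γ) τ) * hexp

namespace IsUniformizingTriple

variable {a t : ℝ} (h : IsUniformizingTriple a t c γ τ)
include h

lemma gamma_im_pos : 0 < γ.im := by simpa using h.gamma_pos

lemma two_gamma_im_lt : 2 * γ.im < π * τ.im := by simpa using h.gamma_lt

lemma tau_im_pos : 0 < τ.im :=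
  pos_of_mul_pos_right ((mul_pos two_pos h.gamma_im_pos).trans h.two_gamma_im_lt) pi_pos.le

lemma theta_two_gamma_ne_zero : theta (2 * γ) τ ≠ 0 :=
  theta_ne_zero_of_im h.tau_im_pos 0 (by simpa using h.gamma_im_pos)
    (by simpa using h.two_gamma_im_lt)

lemma theta_gamma_ne_zero : theta γ τ ≠ 0 := by
  intro hγ
  apply h.theta_two_gamma_ne_zero
  rw [two_mul]
  rw [theta_eq_zero_iff h.tau_im_pos] at hγ ⊢
  exact add_mem hγ hγ

lemma c_sq_mul_theta_gamma : c ^ 2 * theta γ τ = theta (3 * γ) τ := by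
  rw [h.eq_c2, div_mul_cancel₀ _ h.theta_gamma_ne_zero]

lemma c_pow_three_mul_theta_two_gamma : a * c ^ 3 * theta (2 * γ) τ = -theta (4 * γ) τ := by
  rw [h.eq_ac3, neg_mul, div_mul_cancel₀ _ h.theta_two_gamma_ne_zero]

lemma c_ne_zero : c ≠ 0 := by
  rintro rfl
  have h₃ : theta (3 * γ) τ = 0 := by simpa using h.c_sq_mul_theta_gamma.symm
  have h₄ : theta (4 * γ) τ = 0 := by simpa using h.c_pow_three_mul_theta_two_gamma
  refine theta_add_ne_zero h.tau_im_pos h₃ h.theta_gamma_ne_zero ?_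
  rw [← h₄]
  ring_nf

lemma theta_three_gamma_ne_zero : theta (3 * γ) τ ≠ 0 := by
  rw [← h.c_sq_mul_theta_gamma]
  exact mul_ne_zero (pow_ne_zero _ h.c_ne_zero) h.theta_gamma_ne_zero

lemma theta_four_gamma_ne_zero (ha : a ≠ 0) : theta (4 * γ) τ ≠ 0 := by
  rw [← neg_ne_zero, ← h.c_pow_three_mul_theta_two_gamma]
  exact mul_ne_zero (mul_ne_zero (Complex.ofReal_ne_zero.2 ha) (pow_ne_zero _ h.c_ne_zero))
    h.theta_two_gamma_ne_zero

lemma theta_int_mul_gamma_ne_zero (ha : a ≠ 0) {k : ℤ} (hk : k ≠ 0) (hk₄ : |k| ≤ 4) :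
    theta (k * γ) τ ≠ 0 := by
  have h₁ := h.theta_gamma_ne_zero
  have h₂ := h.theta_two_gamma_ne_zero
  have h₃ := h.theta_three_gamma_ne_zero
  have h₄ := h.theta_four_gamma_ne_zero ha
  obtain ⟨hk_ge, hk_le⟩ := abs_le.1 hk₄
  interval_cases k <;> simp_all

lemma conj_theta_mul_gamma (k : ℝ) : (starRingEnd ℂ) (theta (k * γ) τ) = theta (k * γ) τ := by
  have hγ : (starRingEnd ℂ) γ = -γ := by apply Complex.ext <;> simp [h.gamma_re]
  rw [theta_conj h.tau_re, map_mul, hγ, Complex.conj_ofReal, mul_neg, theta_neg, neg_neg]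

lemma conj_c (ha : a ≠ 0) : (starRingEnd ℂ) c = c := by
  have h₁ := h.conj_theta_mul_gamma 1
  have h₂ := h.conj_theta_mul_gamma 2
  have h₃ := h.conj_theta_mul_gamma 3
  have h₄ := h.conj_theta_mul_gamma 4
  norm_num at h₁ h₂ h₃ h₄
  have hsq : (starRingEnd ℂ) (c ^ 2) = c ^ 2 := by rw [h.eq_c2, map_div₀, h₁, h₃]
  have hcube : (starRingEnd ℂ) (a * c ^ 3) = a * c ^ 3 := by
    rw [h.eq_ac3, map_neg, map_div₀, h₂, h₄]
  rw [map_mul, Complex.conj_ofReal, pow_succ, map_mul, hsq] at hcube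
  exact mul_left_cancel₀ (pow_ne_zero 2 h.c_ne_zero)
    (mul_left_cancel₀ (Complex.ofReal_ne_zero.2 ha) hcube)

lemma c_div_t_mul_theta' : c / t * theta' 0 τ * theta γ τ =
    4 * theta' γ τ * theta (2 * γ) τ - 2 * theta' (2 * γ) τ * theta γ τ := by
  have h₀ := theta'_zero_ne_zero h.tau_im_pos
  have h₁ := h.theta_gamma_ne_zero
  rw [h.eq_c_on_t]
  field_simp

end IsUniformizingTriple

/-- The common denominator of `X`, `Y`, `1 / X` and `1 / Y`. -/
noncomputable def kernelDenom (γ τ z : ℂ) : ℂ := ∏ k ∈ Finset.Icc (-2 : ℤ) 2, theta (z + k * γ) τ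

/-- The numerator of `c S(X, Y)` over the denominator `kernelDenom`. -/
noncomputable def kernelNum (a : ℝ) (c γ τ z : ℂ) : ℂ :=
  c ^ 2 * theta z τ ^ 2 * (theta (z + γ) τ ^ 2 * theta (z - 2 * γ) τ +
    theta (z - γ) τ ^ 2 * theta (z + 2 * γ) τ) +
  theta (z + 2 * γ) τ * theta (z - 2 * γ) τ * (theta (z - γ) τ ^ 2 * theta (z + 2 * γ) τ +
    theta (z + γ) τ ^ 2 * theta (z - 2 * γ) τ) +
  a * c ^ 3 * theta z τ ^ 3 * theta (z + γ) τ * theta (z - γ) τ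

lemma kernelDenom_eq (γ τ z : ℂ) : kernelDenom γ τ z = theta z τ * theta (z + γ) τ *
    theta (z - γ) τ * theta (z + 2 * γ) τ * theta (z - 2 * γ) τ := by
  rw [kernelDenom, show Finset.Icc (-2 : ℤ) 2 = {-2, -1, 0, 1, 2} from rfl]
  simp only [Finset.mem_insert, Finset.mem_singleton, reduceCtorEq, or_self, not_false_eq_true,
    Finset.prod_insert, Finset.prod_singleton, Int.reduceNeg, Int.reduceEq, Int.cast_neg,
    Int.cast_ofNat, Int.cast_one, Int.cast_zero, neg_mul, one_mul, zero_mul, add_zero,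
    ← sub_eq_add_neg]
  ring

lemma kernelNum_eq_stepPoly_mul (a : ℝ) (hc : c ≠ 0) {z : ℂ} (hX : X c γ τ z ≠ 0)
    (hY : Y c γ τ z ≠ 0) :
    kernelNum a c γ τ z = c * stepPoly a (X c γ τ z) (Y c γ τ z) * kernelDenom γ τ z := by
  simp only [X, Y, ne_eq, mul_eq_zero, div_eq_zero_iff, not_or] at hX hY
  obtain ⟨-, ⟨hz, hγ⟩, hγ', h2γ⟩ := hX
  obtain ⟨-, -, -, h2γ'⟩ := hY
  rw [kernelNum, kernelDenom_eq, stepPoly, X, Y]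
  generalize theta (z + 2 * γ) τ = u, theta (z - 2 * γ) τ = v at h2γ h2γ' ⊢
  field_simp
  ring

lemma differentiable_kernelNum (a : ℝ) (c γ : ℂ) (hτ : 0 < τ.im) :
    Differentiable ℂ (kernelNum a c γ τ) := by
  unfold kernelNum
  fun_prop (disch := assumption)

lemma kernelNum_neg (a : ℝ) (c γ τ z : ℂ) : kernelNum a c γ τ (-z) = -kernelNum a c γ τ z := by
  rw [kernelNum, kernelNum, show -z + γ = -(z - γ) by ring, show -z - γ = -(z + γ) by ring,
    show -z + 2 * γ = -(z - 2 * γ) by ring, show -z - 2 * γ = -(z + 2 * γ) by ring]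
  simp only [theta_neg]
  ring

lemma kernelNum_add_pi (a : ℝ) (c γ τ z : ℂ) :
    kernelNum a c γ τ (z + π) = -1 * kernelNum a c γ τ z := by
  simp only [kernelNum, sub_eq_add_neg, theta_add_pi_add, theta_add_pi]
  ring

lemma kernelNum_add_pi_mul (a : ℝ) (c γ : ℂ) (hτ : 0 < τ.im) (z : ℂ) :
    kernelNum a c γ τ (z + π * τ) = thetaMultiplier τ z ^ 5 * kernelNum a c γ τ z := by
  have hexp : exp (-(2 * I * (2 * γ))) = exp (-(2 * I * γ)) ^ 2 := by
    rw [← Complex.exp_nat_mul]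
    congr 1
    push_cast
    ring
  have hexp0 := Complex.exp_ne_zero (-(2 * I * γ))
  simp only [kernelNum, sub_eq_add_neg, theta_add_pi_mul_add hτ, theta_add_pi_mul hτ, mul_neg,
    Complex.exp_neg (-(2 * I * γ)), Complex.exp_neg (-(2 * I * (2 * γ))), hexp]
  field_simp

lemma kernelDenom_add_pi (γ τ z : ℂ) :
    kernelDenom γ τ (z + π) = -1 * kernelDenom γ τ z := by
  simp only [kernelDenom_eq, sub_eq_add_neg, theta_add_pi_add, theta_add_pi]
  ring

lemma kernelDenom_add_pi_mul (γ : ℂ) (hτ : 0 < τ.im) (z : ℂ) :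
    kernelDenom γ τ (z + π * τ) = thetaMultiplier τ z ^ 5 * kernelDenom γ τ z := by
  have hexp0 := Complex.exp_ne_zero (-(2 * I * γ))
  simp only [kernelDenom_eq, sub_eq_add_neg, theta_add_pi_mul_add hτ, theta_add_pi_mul hτ, mul_neg,
    Complex.exp_neg (-(2 * I * γ)), Complex.exp_neg (-(2 * I * (2 * γ)))]
  field_simp

lemma differentiable_kernelDenom (γ : ℂ) (hτ : 0 < τ.im) : Differentiable ℂ (kernelDenom γ τ) := by
  unfold kernelDenom
  fun_prop (disch := assumption)

lemma deriv_kernelDenom_neg_int_mul (hτ : 0 < τ.im) {k : ℤ} (hk : k ∈ Finset.Icc (-2 : ℤ) 2) :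
    deriv (kernelDenom γ τ) (-(k * γ)) =
      theta' 0 τ * ∏ j ∈ (Finset.Icc (-2 : ℤ) 2).erase k, theta ((j - k : ℤ) * γ) τ := by
  have hfactor : kernelDenom γ τ = fun z =>
      theta (z + k * γ) τ * ∏ j ∈ (Finset.Icc (-2 : ℤ) 2).erase k, theta (z + j * γ) τ :=
    funext fun z => (Finset.mul_prod_erase _ _ hk).symm
  have hprod : Differentiable ℂ fun z =>
      ∏ j ∈ (Finset.Icc (-2 : ℤ) 2).erase k, theta (z + j * γ) τ := by
    fun_prop (disch := assumption)
  rw [hfactor, ((hasDerivAt_theta_add hτ _ _).fun_mul (hprod _).hasDerivAt).deriv, neg_add_cancel,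
    theta_zero, zero_mul, add_zero]
  congr 1
  refine Finset.prod_congr rfl fun j _ => ?_
  push_cast
  ring_nf

lemma hasDerivAt_kernelNum_zero (a : ℝ) (c γ : ℂ) (hτ : 0 < τ.im) :
    HasDerivAt (kernelNum a c γ τ) (theta γ τ * theta (2 * γ) τ ^ 2 *
      (4 * theta' γ τ * theta (2 * γ) τ - 2 * theta' (2 * γ) τ * theta γ τ)) 0 := by
  have h₀ := (differentiable_theta hτ 0).hasDerivAt
  have hadd (s : ℂ) : HasDerivAt (fun z => theta (z + s) τ) (theta' s τ) 0 := by
    simpa using hasDerivAt_theta_add hτ s 0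
  have hsub (s : ℂ) : HasDerivAt (fun z => theta (z - s) τ) (theta' s τ) 0 := by
    simpa [sub_eq_add_neg, theta'_neg] using hasDerivAt_theta_add hτ (-s) 0
  refine (((((h₀.fun_pow 2).const_mul (c ^ 2)).fun_mul ((((hadd γ).fun_pow 2).fun_mul
    (hsub (2 * γ))).fun_add (((hsub γ).fun_pow 2).fun_mul (hadd (2 * γ))))).fun_add
    (((hadd (2 * γ)).fun_mul (hsub (2 * γ))).fun_mul ((((hsub γ).fun_pow 2).fun_mul
    (hadd (2 * γ))).fun_add (((hadd γ).fun_pow 2).fun_mul (hsub (2 * γ)))))).fun_add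
    ((((h₀.fun_pow 3).const_mul (a * c ^ 3)).fun_mul (hadd γ)).fun_mul (hsub γ))).congr_deriv ?_
  simp only [theta_zero, zero_add, zero_sub, theta_neg]
  ring

namespace IsUniformizingTriple

variable {a t : ℝ} (h : IsUniformizingTriple a t c γ τ)
include h

lemma kernelNum_int_mul_gamma_eq_zero {k : ℤ} (hk : k ∈ Finset.Icc (-2 : ℤ) 2) :
    kernelNum a c γ τ (k * γ) = 0 := by
  have h₀ : kernelNum a c γ τ 0 = 0 := by
    simp only [kernelNum, zero_add, zero_sub, theta_neg, theta_zero]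
    ring
  have h₁ : kernelNum a c γ τ γ = 0 := by
    rw [kernelNum, sub_self, theta_zero, show γ - 2 * γ = -γ by ring, theta_neg,
      show γ + 2 * γ = 3 * γ by ring, ← h.c_sq_mul_theta_gamma]
    ring
  have h₂ : kernelNum a c γ τ (2 * γ) = 0 := by
    rw [kernelNum, sub_self, theta_zero, show 2 * γ + γ = 3 * γ by ring,
      show 2 * γ - γ = γ by ring, show 2 * γ + 2 * γ = 4 * γ by ring]
    linear_combination theta (2 * γ) τ ^ 2 * theta γ τ * theta (4 * γ) τ * h.c_sq_mul_theta_gamma +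
      theta (2 * γ) τ ^ 2 * theta γ τ * theta (3 * γ) τ * h.c_pow_three_mul_theta_two_gamma
  obtain ⟨hk_ge, hk_le⟩ := Finset.mem_Icc.1 hk
  interval_cases k <;> simp [kernelNum_neg, h₀, h₁, h₂]

lemma deriv_kernelDenom_ne_zero (ha : a ≠ 0) {k : ℤ} (hk : k ∈ Finset.Icc (-2 : ℤ) 2) :
    deriv (kernelDenom γ τ) (-(k * γ)) ≠ 0 := by
  rw [deriv_kernelDenom_neg_int_mul h.tau_im_pos hk]
  refine mul_ne_zero (theta'_zero_ne_zero h.tau_im_pos) (Finset.prod_ne_zero_iff.2 fun j hj => ?_)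
  obtain ⟨hne, hj⟩ := Finset.mem_erase.1 hj
  rw [Finset.mem_Icc] at hk hj
  exact h.theta_int_mul_gamma_ne_zero ha (sub_ne_zero.2 hne) (abs_le.2 (by lia))

lemma exists_kernelNum_eq_mul (ha : a ≠ 0) :
    ∃ κ, ∀ z, kernelNum a c γ τ z = κ * kernelDenom γ τ z := by
  have hτ := h.tau_im_pos
  refine exists_eq_const_mul_of_quasiPeriodic (thetaPeriods hτ) (u₁ := fun _ => -1)
    (u₂ := fun z => thetaMultiplier τ z ^ 5) (differentiable_kernelNum a c γ hτ)
    (differentiable_kernelDenom γ hτ) (by simp)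
    (fun z => pow_ne_zero 5 (thetaMultiplier_ne_zero τ z)) (kernelNum_add_pi a c γ τ)
    (kernelNum_add_pi_mul a c γ hτ) (kernelDenom_add_pi γ τ) (kernelDenom_add_pi_mul γ hτ)
    fun z => ?_
  by_cases hz : kernelDenom γ τ z = 0
  · obtain ⟨k, hk, hzk⟩ := Finset.prod_eq_zero_iff.1 hz
    refine ⟨-(z + k * γ), neg_mem ((theta_eq_zero_iff hτ).1 hzk), fun _ => ?_⟩
    rw [show z + -(z + k * γ) = -(k * γ) by ring, kernelNum_neg,
      h.kernelNum_int_mul_gamma_eq_zero hk, neg_zero]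
    exact ⟨rfl, h.deriv_kernelDenom_ne_zero ha hk⟩
  · exact ⟨0, zero_mem _, fun h0 => absurd (by simpa using h0) hz⟩

lemma kernelNum_eq (ha : a ≠ 0) (z : ℂ) : kernelNum a c γ τ z = c / t * kernelDenom γ τ z := by
  obtain ⟨κ, hκ⟩ := h.exists_kernelNum_eq_mul ha
  have h0 : (0 : ℤ) ∈ Finset.Icc (-2 : ℤ) 2 := by simp
  have hderiv_ne := h.deriv_kernelDenom_ne_zero ha h0
  have hderiv := deriv_kernelDenom_neg_int_mul (γ := γ) h.tau_im_pos h0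
  rw [show (Finset.Icc (-2 : ℤ) 2).erase 0 = {-2, -1, 1, 2} from rfl] at hderiv
  simp only [Int.cast_zero, zero_mul, neg_zero, Int.reduceNeg, sub_zero, Finset.mem_insert,
    Int.reduceEq, Finset.mem_singleton, or_self, not_false_eq_true, Finset.prod_insert,
    Int.cast_neg, Int.cast_ofNat, neg_mul, theta_neg, Int.cast_one, one_mul,
    Finset.prod_singleton] at hderiv hderiv_ne
  have hκ_mul : κ * deriv (kernelDenom γ τ) 0 = c / t * deriv (kernelDenom γ τ) 0 := by
    rw [← deriv_const_mul_field, ← funext hκ,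
      (hasDerivAt_kernelNum_zero a c γ h.tau_im_pos).deriv, hderiv]
    linear_combination -(theta γ τ * theta (2 * γ) τ ^ 2) * h.c_div_t_mul_theta'
  rw [hκ, mul_right_cancel₀ hderiv_ne hκ_mul]

lemma stepPoly_X_Y (ha : a ≠ 0) {z : ℂ} (hX : X c γ τ z ≠ 0) (hY : Y c γ τ z ≠ 0) :
    stepPoly a (X c γ τ z) (Y c γ τ z) = 1 / t := by
  have hdenom : kernelDenom γ τ z ≠ 0 := by
    simp only [X, Y, ne_eq, mul_eq_zero, div_eq_zero_iff, not_or] at hX hY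
    simp [kernelDenom_eq, hX, hY]
  refine mul_left_cancel₀ h.c_ne_zero (mul_right_cancel₀ hdenom ?_)
  rw [← kernelNum_eq_stepPoly_mul a h.c_ne_zero hX hY, h.kernelNum_eq ha, mul_one_div]

end IsUniformizingTriple

end Uniformization

section Strip

/-- The closed horizontal strip between the real line and its translate by `-γ`. Reflection in
`-γ / 2` exchanges its boundary lines and leaves `X` and the decoupled function invariant. -/
def strip (γ : ℂ) : Set ℂ := {z | -γ.im ≤ z.im ∧ z.im ≤ 0}

lemma convex_strip (γ : ℂ) : Convex ℝ (strip γ) :=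
  (convex_halfSpace_im_ge _).inter (convex_halfSpace_im_le _)

variable {E : Type*} [NormedAddCommGroup E] {γ : ℂ}

lemma neg_gamma_sub_mem_strip {z : ℂ} (hz : z ∈ strip γ) : -γ - z ∈ strip γ := by
  obtain ⟨hz_ge, hz_le⟩ := hz
  constructor <;> simp <;> linarith

lemma strip_mem_nhds {z : ℂ} (h₁ : -γ.im < z.im) (h₂ : z.im < 0) : strip γ ∈ 𝓝 z :=
  mem_of_superset ((isOpen_Ioo.preimage Complex.continuous_im).mem_nhds ⟨h₁, h₂⟩)
    fun _ hw => ⟨hw.1.le, hw.2.le⟩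

lemma ofReal_mem_strip (hγ : 0 < γ.im) (s : ℝ) : (s : ℂ) ∈ strip γ := by simp [strip, hγ.le]

lemma neg_half_mem_strip (hγ : 0 < γ.im) : -(γ / 2) ∈ strip γ := by
  constructor <;> simp <;> linarith

lemma exists_isMaxOn_strip {f : ℂ → E} (hγ : 0 < γ.im) (hf : ContinuousOn f (strip γ))
    (hper : ∀ z ∈ strip γ, f (z + π) = f z) : ∃ z ∈ strip γ, IsMaxOn (norm ∘ f) (strip γ) z := by
  have hcompact : IsCompact (Icc 0 π ×ℂ Icc (-γ.im) 0) := isCompact_Icc.reProdIm isCompact_Icc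
  have hsub : Icc 0 π ×ℂ Icc (-γ.im) 0 ⊆ strip γ := fun z hz => hz.2
  obtain ⟨z, hz, hmax⟩ := hcompact.exists_isMaxOn
    ⟨0, by simp [Complex.mem_reProdIm, pi_pos.le, hγ.le]⟩ (hf.mono hsub).norm
  refine ⟨z, hsub hz, fun w hw => ?_⟩
  have hper_line : Function.Periodic (fun s : ℝ => f (s + w.im * I)) π := fun s => by
    beta_reduce
    rw [Complex.ofReal_add, add_right_comm, hper]
    simpa [strip] using hw
  obtain ⟨s, hs, hws⟩ := hper_line.exists_mem_Ico₀ pi_pos w.re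
  simp only [Complex.re_add_im] at hws
  have hmem : s + w.im * I ∈ Icc 0 π ×ℂ Icc (-γ.im) 0 := by
    simpa [Complex.mem_reProdIm] using ⟨⟨hs.1, hs.2.le⟩, hw⟩
  simpa [hws] using hmax hmem

variable [NormedSpace ℂ E] [CompleteSpace E] [StrictConvexSpace ℝ E] {f : ℂ → E}

lemma eqOn_const_of_isLocalMax_norm {U : Set ℂ} (hf : AnalyticOnNhd ℂ f U) (hU : IsPreconnected U)
    {z : ℂ} (hz : z ∈ U) (hmax : IsLocalMax (norm ∘ f) z) : EqOn f (fun _ => f z) U :=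
  hf.eqOn_of_preconnected_of_eventuallyEq analyticOnNhd_const hU hz
    (Complex.eventually_eq_of_isLocalMax_norm
      ((hf z hz).eventually_analyticAt.mono fun _ hw => hw.differentiableAt) hmax)

lemma exists_real_isMaxOn_strip (hγ : 0 < γ.im) (hf : AnalyticOnNhd ℂ f (strip γ))
    (hper : ∀ z ∈ strip γ, f (z + π) = f z) (hsymm : ∀ z ∈ strip γ, f (-γ - z) = f z) :
    ∃ s : ℝ, IsMaxOn (norm ∘ f) (strip γ) s := by
  obtain ⟨p, hp, hmax⟩ := exists_isMaxOn_strip hγ hf.continuousOn hper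
  suffices ∃ s : ℝ, f s = f p from this.imp fun s hs z hz => by simpa [hs] using hmax hz
  rcases hp.1.eq_or_lt with hlower | hlower
  · refine ⟨(-γ - p).re, ?_⟩
    rw [← hsymm p hp]
    congr 1
    apply Complex.ext <;> simp [← hlower]
  rcases hp.2.eq_or_lt with hupper | hupper
  · refine ⟨p.re, ?_⟩
    congr 1
    apply Complex.ext <;> simp [hupper]
  exact ⟨0, eqOn_const_of_isLocalMax_norm hf (convex_strip γ).isPreconnected hp
    (hmax.isLocalMax (strip_mem_nhds hlower hupper)) (ofReal_mem_strip hγ 0)⟩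

end Strip

section Regions

lemma mapsTo_connectedComponentIn {α β : Type*} [TopologicalSpace α] [TopologicalSpace β]
    {f : α → β} {U : Set α} {V : Set β} (hf : ContinuousOn f U) (hmaps : MapsTo f U V) {p : α}
    (hp : p ∈ U) : MapsTo f (connectedComponentIn U p) (connectedComponentIn V (f p)) :=
  (hf.mapsTo_connectedComponentIn hp).mono_right (connectedComponentIn_mono _ hmaps.image_subset)

/-- The set `{z : |X(z)| < 1}`, without the poles of `X`; `regionX` is a component of it. -/
def domainX (c γ τ : ℂ) : Set ℂ :=
  {z | theta (z - γ) τ * theta (z + 2 * γ) τ ≠ 0 ∧ ‖X c γ τ z‖ < 1}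

variable {c γ τ : ℂ}

lemma X_zero (c γ τ : ℂ) : X c γ τ 0 = 0 := by simp [X]

lemma regionX_eq (c γ τ : ℂ) :
    regionX c γ τ = connectedComponentIn (domainX c γ τ) (-(γ / 2)) :=
  rfl

lemma regionX_subset (c γ τ : ℂ) : regionX c γ τ ⊆ domainX c γ τ := connectedComponentIn_subset _ _

lemma analyticAt_X (hτ : 0 < τ.im) {z : ℂ} (hz : theta (z - γ) τ * theta (z + 2 * γ) τ ≠ 0) :
    AnalyticAt ℂ (X c γ τ) z := by
  have hnum : Differentiable ℂ fun z => theta z τ * theta (z + γ) τ := by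
    fun_prop (disch := assumption)
  have hdenom : Differentiable ℂ fun z => theta (z - γ) τ * theta (z + 2 * γ) τ := by
    fun_prop (disch := assumption)
  exact analyticAt_const.mul ((hnum.analyticAt z).div (hdenom.analyticAt z) hz)

lemma analyticOnNhd_X_domainX (c γ : ℂ) (hτ : 0 < τ.im) :
    AnalyticOnNhd ℂ (X c γ τ) (domainX c γ τ) := fun _ hz => analyticAt_X hτ hz.1

lemma isOpen_domainX (c γ : ℂ) (hτ : 0 < τ.im) : IsOpen (domainX c γ τ) := by
  have hdenom : Differentiable ℂ fun z => theta (z - γ) τ * theta (z + 2 * γ) τ := by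
    fun_prop (disch := assumption)
  refine isOpen_iff_mem_nhds.2 fun z hz => ?_
  exact (hdenom.continuous.continuousAt.eventually_ne hz.1).and
    ((analyticAt_X hτ hz.1).continuousAt.norm.eventually_lt_const hz.2)

lemma isOpen_regionX (c γ : ℂ) (hτ : 0 < τ.im) : IsOpen (regionX c γ τ) :=
  (isOpen_domainX c γ hτ).connectedComponentIn

lemma periodic_mem_domainX (c γ : ℂ) (hτ : 0 < τ.im) {l : ℂ} (hl : l ∈ (thetaPeriods hτ).lattice) :
    Function.Periodic (· ∈ domainX c γ τ) l := by
  refine periodic_of_mem_lattice (L := thetaPeriods hτ) (fun z => ?_) (fun z => ?_) hl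
  · simp only [domainX, mem_ofPred_eq, thetaPeriods, periodic_X_pi c γ τ z, sub_eq_add_neg,
      theta_add_pi_add, neg_mul_neg]
  · have hμ := thetaMultiplier_ne_zero τ z
    simp [domainX, thetaPeriods, periodic_X_pi_mul c γ hτ z, sub_eq_add_neg,
      theta_add_pi_mul_add hτ, hμ]

lemma periodic_X (c γ : ℂ) (hτ : 0 < τ.im) {l : ℂ} (hl : l ∈ (thetaPeriods hτ).lattice) :
    Function.Periodic (X c γ τ) l :=
  periodic_of_mem_lattice (L := thetaPeriods hτ) (periodic_X_pi c γ τ) (periodic_X_pi_mul c γ hτ) hl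

lemma neg_mem_regionX {z : ℂ} (hz : z ∈ regionY c γ τ) : -z ∈ regionX c γ τ := by
  refine mapsTo_connectedComponentIn continuousOn_neg (fun w hw => ?_)
    (connectedComponentIn_nonempty_iff.1 ⟨z, hz⟩) hz
  rw [mem_ofPred_eq, Y_eq_X_neg] at hw
  rwa [mem_ofPred_eq, show -w - γ = -(w + γ) by ring, show -w + 2 * γ = -(w - 2 * γ) by ring,
    theta_neg, theta_neg, neg_mul_neg]

namespace IsUniformizingTriple

variable {a t : ℝ} (h : IsUniformizingTriple a t c γ τ)
include h

lemma denominator_ne_zero {z : ℂ} (hz : z ∈ strip γ) :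
    theta (z - γ) τ * theta (z + 2 * γ) τ ≠ 0 := by
  have hγ := h.gamma_im_pos
  have hγτ := h.two_gamma_im_lt
  obtain ⟨hz_ge, hz_le⟩ := hz
  refine mul_ne_zero (theta_ne_zero_of_im h.tau_im_pos (-1) ?_ ?_)
    (theta_ne_zero_of_im h.tau_im_pos 0 ?_ ?_) <;> simp <;> linarith

lemma analyticOnNhd_X_strip : AnalyticOnNhd ℂ (X c γ τ) (strip γ) :=
  fun _ hz => analyticAt_X h.tau_im_pos (h.denominator_ne_zero hz)

lemma conj_X (ha : a ≠ 0) (z : ℂ) :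
    (starRingEnd ℂ) (X c γ τ z) = Y c γ τ ((starRingEnd ℂ) z) := by
  have hγ : (starRingEnd ℂ) γ = -γ := by apply Complex.ext <;> simp [h.gamma_re]
  simp only [X, Y, map_mul, map_div₀, theta_conj h.tau_re, map_add, map_sub, map_ofNat,
    h.conj_c ha, hγ, mul_neg, neg_mul, neg_neg, sub_neg_eq_add, ← sub_eq_add_neg]

lemma norm_X_real_ne_one (ha : a ≠ 0) (ht : t ≠ 0) (hat : (|a| + 4) * |t| < 1) (s : ℝ) :
    ‖X c γ τ s‖ ≠ 1 := by
  intro hX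
  have hY : ‖Y c γ τ s‖ = 1 := by
    rw [← Complex.conj_ofReal, ← h.conj_X ha, RCLike.norm_conj, hX]
  have hkernel := h.stepPoly_X_Y ha (z := s) (norm_ne_zero_iff.1 (by simp [hX]))
    (norm_ne_zero_iff.1 (by simp [hY]))
  have hle : ‖stepPoly a (X c γ τ s) (Y c γ τ s)‖ ≤ 1 + 1 + 1 + 1 + |a| := by
    refine norm_add_le_of_le (norm_add_le_of_le (norm_add_le_of_le (norm_add_le_of_le hX.le hY.le)
      ?_) ?_) ?_ <;> simp [hX, hY]
  rw [hkernel, norm_div, norm_one, Complex.norm_real, Real.norm_eq_abs,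
    div_le_iff₀ (abs_pos.2 ht)] at hle
  linarith

lemma norm_X_real_lt_one (ha : a ≠ 0) (ht : t ≠ 0) (hat : (|a| + 4) * |t| < 1) (s : ℝ) :
    ‖X c γ τ s‖ < 1 := by
  by_contra! hge
  have hcont : Continuous fun s : ℝ => ‖X c γ τ s‖ := continuous_iff_continuousAt.2 fun s =>
    ((h.analyticOnNhd_X_strip s (ofReal_mem_strip h.gamma_im_pos s)).continuousAt.comp
      Complex.continuous_ofReal.continuousAt).norm
  obtain ⟨r, hr⟩ := mem_range_of_exists_le_of_exists_ge hcont ⟨0, by simp [X_zero]⟩ ⟨s, hge⟩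
  exact h.norm_X_real_ne_one ha ht hat r hr

lemma norm_X_lt_one (ha : a ≠ 0) (ht : t ≠ 0) (hat : (|a| + 4) * |t| < 1) {z : ℂ}
    (hz : z ∈ strip γ) : ‖X c γ τ z‖ < 1 := by
  obtain ⟨s, hs⟩ := exists_real_isMaxOn_strip h.gamma_im_pos h.analyticOnNhd_X_strip
    (fun z _ => periodic_X_pi c γ τ z) fun z _ => X_neg_gamma_sub c γ τ z
  exact (hs hz).trans_lt (h.norm_X_real_lt_one ha ht hat s)

lemma strip_subset_domainX (ha : a ≠ 0) (ht : t ≠ 0) (hat : (|a| + 4) * |t| < 1) :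
    strip γ ⊆ domainX c γ τ :=
  fun _ hz => ⟨h.denominator_ne_zero hz, h.norm_X_lt_one ha ht hat hz⟩

lemma strip_subset_regionX (ha : a ≠ 0) (ht : t ≠ 0) (hat : (|a| + 4) * |t| < 1) :
    strip γ ⊆ regionX c γ τ :=
  (convex_strip γ).isPreconnected.subset_connectedComponentIn (neg_half_mem_strip h.gamma_im_pos)
    (h.strip_subset_domainX ha ht hat)

lemma X_ne_zero {z : ℂ} (hz_lt : -γ.im < z.im) (hz_le : z.im ≤ 0) (hz : theta z τ ≠ 0) :
    X c γ τ z ≠ 0 := by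
  have hγτ := h.two_gamma_im_lt
  refine mul_ne_zero h.c_ne_zero (div_ne_zero (mul_ne_zero hz ?_)
    (h.denominator_ne_zero ⟨hz_lt.le, hz_le⟩))
  exact theta_ne_zero_of_im h.tau_im_pos 0 (by simp; linarith) (by simp; linarith)

lemma X_neg_half_gamma_ne_zero : X c γ τ (-(γ / 2)) ≠ 0 := by
  have hγ := h.gamma_im_pos
  have hγτ := h.two_gamma_im_lt
  exact h.X_ne_zero (by simp; linarith) (by simp; linarith)
    (theta_ne_zero_of_im h.tau_im_pos (-1) (by simp; linarith) (by simp; linarith))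

lemma X_num_ne_zero_of_denom_eq_zero {z : ℂ} (hz : theta (z - γ) τ * theta (z + 2 * γ) τ = 0) :
    theta z τ * theta (z + γ) τ ≠ 0 := by
  have hτ := h.tau_im_pos
  have h₁ := h.theta_gamma_ne_zero
  have h₂ := h.theta_two_gamma_ne_zero
  rcases mul_eq_zero.1 hz with hz | hz
  · have hz₁ := theta_add_ne_zero hτ hz h₁
    have hz₂ := theta_add_ne_zero hτ hz h₂
    rw [show z - γ + γ = z by ring] at hz₁
    rw [show z - γ + 2 * γ = z + γ by ring] at hz₂
    exact mul_ne_zero hz₁ hz₂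
  · have hz₁ := theta_add_ne_zero hτ hz (w := -γ) (by simpa using h₁)
    have hz₂ := theta_add_ne_zero hτ hz (w := -(2 * γ)) (by simpa using h₂)
    rw [show z + 2 * γ + -γ = z + γ by ring] at hz₁
    rw [add_neg_cancel_right] at hz₂
    exact mul_ne_zero hz₂ hz₁

lemma mem_domainX_of_tendsto {ι : Type*} {f : Filter ι} [f.NeBot] {v : ι → ℂ} {p x : ℂ}
    (hv : ∀ᶠ i in f, v i ∈ domainX c γ τ) (hvp : Tendsto v f (𝓝 p))
    (hXv : Tendsto (fun i => X c γ τ (v i)) f (𝓝 x)) (hx : ‖x‖ < 1) :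
    p ∈ domainX c γ τ ∧ X c γ τ p = x := by
  have hτ := h.tau_im_pos
  have hnum : Differentiable ℂ fun z => c * (theta z τ * theta (z + γ) τ) := by
    fun_prop (disch := assumption)
  have hdenom : Differentiable ℂ fun z => theta (z - γ) τ * theta (z + 2 * γ) τ := by
    fun_prop (disch := assumption)
  have hnum_eq : c * (theta p τ * theta (p + γ) τ) =
      x * (theta (p - γ) τ * theta (p + 2 * γ) τ) := by
    refine tendsto_nhds_unique ((hnum.continuous.tendsto p).comp hvp)
      ((hXv.mul ((hdenom.continuous.tendsto p).comp hvp)).congr' (hv.mono fun i hi => ?_))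
    simp only [Function.comp_apply]
    rw [X, mul_assoc, div_mul_cancel₀ _ hi.1]
  have hdenom_ne : theta (p - γ) τ * theta (p + 2 * γ) τ ≠ 0 := by
    intro hzero
    refine mul_ne_zero h.c_ne_zero (h.X_num_ne_zero_of_denom_eq_zero hzero) ?_
    rw [hnum_eq, hzero, mul_zero]
  have hXp : X c γ τ p = x := by rw [X, ← mul_div_assoc, hnum_eq, mul_div_cancel_right₀ _ hdenom_ne]
  exact ⟨⟨hdenom_ne, by rwa [hXp]⟩, hXp⟩

lemma mem_image_regionX_of_mem_closure {x : ℂ} (hx : ‖x‖ < 1)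
    (hcl : x ∈ closure (X c γ τ '' regionX c γ τ)) : x ∈ X c γ τ '' regionX c γ τ := by
  have hτ := h.tau_im_pos
  obtain ⟨u, hu, hux⟩ := mem_closure_iff_seq_limit.1 hcl
  choose v hv hvu using hu
  obtain ⟨K, hK, hcover⟩ := exists_isCompact_forall_add_mem (thetaPeriods hτ)
  choose l hl hvl using fun k => hcover (v k)
  obtain ⟨p, -, φ, hφ, hp⟩ := hK.tendsto_subseq hvl
  have hmem_iff (k : ℕ) (z : ℂ) : z + l k ∈ domainX c γ τ ↔ z ∈ domainX c γ τ :=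
    iff_of_eq (periodic_mem_domainX c γ hτ (hl k) z)
  obtain ⟨hpD, hXp⟩ := h.mem_domainX_of_tendsto (f := atTop) (x := x)
    (.of_forall fun k => (hmem_iff (φ k) _).2 (regionX_subset _ _ _ (hv (φ k)))) hp
    (by simpa [periodic_X c γ hτ (hl _) _, hvu] using! hux.comp hφ.tendsto_atTop) hx
  obtain ⟨k, hk⟩ := (hp.eventually_mem
    ((isOpen_domainX c γ hτ).connectedComponentIn.mem_nhds (mem_connectedComponentIn hpD))).exists
  have hmaps : MapsTo (· - l (φ k)) (domainX c γ τ) (domainX c γ τ) := fun z hz => by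
    rwa [← hmem_iff (φ k), sub_add_cancel]
  have hvk : v (φ k) ∈ connectedComponentIn (domainX c γ τ) (p - l (φ k)) := by
    simpa using mapsTo_connectedComponentIn (by fun_prop) hmaps hpD hk
  refine ⟨p - l (φ k), ?_, by rw [(periodic_X c γ hτ (hl _)).sub_eq, hXp]⟩
  have hvk' := hv (φ k)
  rw [regionX_eq] at hvk' ⊢
  rw [connectedComponentIn_eq hvk', ← connectedComponentIn_eq hvk]
  exact mem_connectedComponentIn (hmaps hpD)

lemma isOpen_image_regionX (ha : a ≠ 0) (ht : t ≠ 0) (hat : (|a| + 4) * |t| < 1) :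
    IsOpen (X c γ τ '' regionX c γ τ) := by
  have hsub := h.strip_subset_regionX ha ht hat
  have hτ := h.tau_im_pos
  rcases ((analyticOnNhd_X_domainX c γ hτ).mono (regionX_subset c γ τ)).is_constant_or_isOpen
    isPreconnected_connectedComponentIn with ⟨w, hw⟩ | hopen
  · have h₀ := hw _ (hsub (ofReal_mem_strip h.gamma_im_pos 0))
    have h₁ := hw _ (hsub (neg_half_mem_strip h.gamma_im_pos))
    rw [Complex.ofReal_zero, X_zero] at h₀
    exact absurd (h₁.trans h₀.symm) h.X_neg_half_gamma_ne_zero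
  · exact hopen _ subset_rfl (isOpen_regionX c γ hτ)

lemma exists_mem_regionX (ha : a ≠ 0) (ht : t ≠ 0) (hat : (|a| + 4) * |t| < 1) {x : ℂ}
    (hx : ‖x‖ < 1) : ∃ z ∈ regionX c γ τ, X c γ τ z = x := by
  have h0 : X c γ τ (0 : ℝ) ∈ X c γ τ '' regionX c γ τ := mem_image_of_mem _
    (h.strip_subset_regionX ha ht hat (ofReal_mem_strip h.gamma_im_pos 0))
  rw [Complex.ofReal_zero, X_zero] at h0
  refine (convex_ball (0 : ℂ) 1).isPreconnected.subset_of_closure_inter_subset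
    (h.isOpen_image_regionX ha ht hat) ⟨0, by simp, h0⟩ (fun y hy => ?_) (mem_ball_zero_iff.2 hx)
  exact h.mem_image_regionX_of_mem_closure (mem_ball_zero_iff.1 hy.2) hy.1

end IsUniformizingTriple
end Regions

section RemovableSingularities

lemma tendsto_sub_mul_div {u v : ℂ → ℂ} {v' p : ℂ} (hu : ContinuousAt u p)
    (hv : HasDerivAt v v' p) (hvp : v p = 0) (hv' : v' ≠ 0) :
    Tendsto (fun z => (z - p) * (u z / v z)) (𝓝[≠] p) (𝓝 (u p / v')) := by
  refine ((hu.mono_left nhdsWithin_le_nhds).div hv.tendsto_slope hv').congr fun z => ?_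
  rw [Pi.div_apply, slope_def_field, hvp, sub_zero, div_div_eq_mul_div]
  ring

lemma meromorphicOrderAt_nonneg_of_tendsto {F : ℂ → ℂ} {p : ℂ} (hF : MeromorphicAt F p)
    (hres : Tendsto (fun z => (z - p) * F z) (𝓝[≠] p) (𝓝 0)) : 0 ≤ meromorphicOrderAt F p := by
  have hsub : MeromorphicAt (· - p) p := by fun_prop
  have hpos := (tendsto_zero_iff_meromorphicOrderAt_pos (hsub.fun_mul hF)).1 hres
  rw [fun_meromorphicOrderAt_mul hsub hF, meromorphicOrderAt_id_sub_const] at hpos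
  cases horder : meromorphicOrderAt F p with
  | top => exact le_top
  | coe n =>
    rw [horder] at hpos
    norm_cast at hpos ⊢
    lia

lemma meromorphicOrderAt_neg_gamma_sub {F : ℂ → ℂ} {γ : ℂ} (hF : ∀ z, F (-γ - z) = F z) (z : ℂ) :
    meromorphicOrderAt F (-γ - z) = meromorphicOrderAt F z := by
  rw [← meromorphicOrderAt_comp_of_deriv_ne_zero (g := fun z => -γ - z) (by fun_prop) (by simp)]
  exact congrArg (meromorphicOrderAt · z) (funext hF)

lemma periodic_meromorphicOrderAt {F : ℂ → ℂ} {l : ℂ} (hF : Function.Periodic F l) :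
    Function.Periodic (meromorphicOrderAt F) l := fun z => by
  rw [← meromorphicOrderAt_comp_add_const_eq_meromorphicOrderAt]
  exact congrArg (meromorphicOrderAt · z) (funext hF)

lemma eqOn_zero_strip_of_odd {G : ℂ → ℂ} {γ : ℂ} (hγ : 0 < γ.im) (hG : AnalyticOnNhd ℂ G (strip γ))
    (hper : ∀ z ∈ strip γ, G (z + π) = G z) (hsymm : ∀ z ∈ strip γ, G (-γ - z) = G z)
    (hodd : ∀ s : ℝ, ∀ᶠ w in 𝓝 (s : ℂ), G (-w) = -G w) : EqOn G 0 (strip γ) := by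
  obtain ⟨s, hs⟩ := exists_real_isMaxOn_strip hγ hG hper hsymm
  have hnear (r : ℝ) : ∀ᶠ w in 𝓝 (r : ℂ), -γ.im < w.im :=
    (isOpen_Ioi.preimage Complex.continuous_im).mem_nhds (by simpa using! hγ)
  have hmax : IsLocalMax (norm ∘ G) s := by
    filter_upwards [hodd s, hnear s,
      continuous_neg.continuousAt.eventually (by simpa using! hnear (-s))] with w hw_odd hw hw_neg
    rcases le_total w.im 0 with hw_im | hw_im
    · exact hs ⟨hw.le, hw_im⟩
    · simpa [hw_odd] using hs (a := -w) ⟨hw_neg.le, by simpa using hw_im⟩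
  have hconst := eqOn_const_of_isLocalMax_norm hG (convex_strip γ).isPreconnected
    (ofReal_mem_strip hγ s) hmax
  have hG0 : G 0 = 0 := by simpa [self_eq_neg] using (hodd 0).self_of_nhds
  intro z hz
  rw [hconst hz, ← hconst (ofReal_mem_strip hγ 0), Complex.ofReal_zero, hG0, Pi.zero_apply]

end RemovableSingularities

section ThetaQuotient

variable {c γ τ : ℂ}

lemma theta_neg_add_pi_div_two (z τ : ℂ) : theta (-z + π / 2) τ = theta (z + π / 2) τ := by
  rw [show -z + (π : ℂ) / 2 = -(z + π / 2) + π by ring, theta_add_pi, theta_neg, neg_neg]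

lemma thetaQuotient_neg (c γ τ z : ℂ) : thetaQuotient c γ τ (-z) = -thetaQuotient c γ τ z := by
  rw [thetaQuotient, thetaQuotient, theta_neg_add_pi_div_two, theta_neg, mul_neg, div_neg]

lemma periodic_thetaQuotient_pi (c γ τ : ℂ) : Function.Periodic (thetaQuotient c γ τ) π :=
  fun z => by
  rw [thetaQuotient, thetaQuotient, theta_add_pi_add, theta_add_pi, mul_neg, mul_neg,
    neg_div_neg_eq]

/-- The constant factor of `thetaQuotient`. -/
noncomputable def quotientConst (c γ τ : ℂ) : ℂ :=
  theta' 0 (γ / π) * theta (2 * γ) τ / (c * theta (π / 2) (γ / π) * theta' 0 τ)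

lemma thetaQuotient_eq (c γ τ z : ℂ) : thetaQuotient c γ τ z =
    quotientConst c γ τ * theta (z + π / 2) (γ / π) / theta z (γ / π) := by
  rw [thetaQuotient, quotientConst, div_mul_eq_mul_div, div_div]

lemma pi_mul_gamma_div_pi (γ : ℂ) : π * (γ / π) = γ :=
  mul_div_cancel₀ γ (Complex.ofReal_ne_zero.2 pi_ne_zero)

lemma pi_mul_gamma_div_pi_im (γ : ℂ) : π * (γ / π).im = γ.im := by
  rw [Complex.div_ofReal_im, mul_div_cancel₀ _ pi_ne_zero]

lemma gamma_div_pi_im_pos (hγ : 0 < γ.im) : 0 < (γ / π).im := by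
  rw [Complex.div_ofReal_im]
  exact div_pos hγ pi_pos

lemma thetaQuotient_neg_gamma_sub (c τ : ℂ) (hγ : 0 < γ.im) (z : ℂ) :
    thetaQuotient c γ τ (-γ - z) = thetaQuotient c γ τ z := by
  have hγπ := gamma_div_pi_im_pos hγ
  have hdenom := theta_add_pi_mul hγπ z
  have hnum := theta_add_pi_mul_add hγπ z (π / 2)
  have hexp : exp (-(2 * I * (π / 2))) = -1 := by
    rw [show -(2 * I * ((π : ℂ) / 2)) = -(π * I) by ring, Complex.exp_neg, Complex.exp_pi_mul_I,
      inv_neg, inv_one]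
  rw [pi_mul_gamma_div_pi] at hdenom hnum
  rw [show -γ - z = -(z + γ) by ring, thetaQuotient_neg, thetaQuotient_eq, thetaQuotient_eq, hnum,
    hdenom, hexp]
  have hμ := thetaMultiplier_ne_zero (γ / π) z
  rw [← mul_div_mul_left _ (theta z (γ / π)) hμ, ← neg_div]
  ring

lemma analyticAt_thetaQuotient (c τ : ℂ) (hγ : 0 < γ.im) {z : ℂ} (hz : theta z (γ / π) ≠ 0) :
    AnalyticAt ℂ (thetaQuotient c γ τ) z := by
  have hγπ := gamma_div_pi_im_pos hγ
  have hnum : Differentiable ℂ fun z => quotientConst c γ τ * theta (z + π / 2) (γ / π) := by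
    fun_prop (disch := assumption)
  exact ((hnum.analyticAt z).fun_div ((differentiable_theta hγπ).analyticAt z) hz).congr
    (.of_forall fun z => (thetaQuotient_eq c γ τ z).symm)

lemma meromorphic_thetaQuotient (c τ : ℂ) (hγ : 0 < γ.im) : Meromorphic (thetaQuotient c γ τ) := by
  have hγπ := gamma_div_pi_im_pos hγ
  have hnum : Differentiable ℂ fun z => quotientConst c γ τ * theta (z + π / 2) (γ / π) := by
    fun_prop (disch := assumption)
  intro z
  rw [funext (thetaQuotient_eq c γ τ)]
  exact (hnum.analyticAt z).meromorphicAt.fun_div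
    ((differentiable_theta hγπ).analyticAt z).meromorphicAt

lemma exists_int_mul_pi_of_theta_eq_zero (hτ : 0 < τ.im) {z : ℂ} (hz : theta z τ = 0)
    (hz_gt : -(π * τ.im) < z.im) (hz_lt : z.im < π * τ.im) : ∃ m : ℤ, z = m * π := by
  have hπτ := mul_pos pi_pos hτ
  rw [theta_eq_zero_iff hτ, PeriodPair.mem_lattice] at hz
  obtain ⟨m, n, hmn⟩ := hz
  have him : z.im = n * (π * τ.im) := by simp [← hmn, thetaPeriods]
  have hn_gt : (-1 : ℝ) < n := lt_of_mul_lt_mul_right (by linarith) hπτ.le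
  have hn_lt : (n : ℝ) < 1 := lt_of_mul_lt_mul_right (by linarith) hπτ.le
  norm_cast at hn_gt hn_lt
  obtain rfl : n = 0 := by lia
  exact ⟨m, by simp [← hmn, thetaPeriods]⟩

end ThetaQuotient

section Discrepancy

variable {a t : ℝ} {c γ τ : ℂ}

/-- The part `1 / X + J` of the decoupled function that remains bounded in the strip, with `J`
taken to be `thetaQuotient`. -/
noncomputable def polarPart (c γ τ z : ℂ) : ℂ := 1 / X c γ τ z + thetaQuotient c γ τ z

/-- The part `1 / (2t) - a t x Q(x, 0) - x` of the decoupled function, which is holomorphic in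
`x = X(z)` on the unit disc. -/
noncomputable def regularPart (a t : ℝ) (x : ℂ) : ℂ := 1 / (2 * t) - a * t * x * Q a t x 0 - x

/-- The difference between the decoupled function, as given by `Q(x, 0)` at `x = X(z)`, and
`thetaQuotient`. -/
noncomputable def discrepancy (a t : ℝ) (c γ τ z : ℂ) : ℂ :=
  regularPart a t (X c γ τ z) - polarPart c γ τ z

lemma polarPart_neg_gamma_sub (c τ : ℂ) (hγ : 0 < γ.im) (z : ℂ) :
    polarPart c γ τ (-γ - z) = polarPart c γ τ z := by
  rw [polarPart, polarPart, X_neg_gamma_sub, thetaQuotient_neg_gamma_sub c τ hγ]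

lemma periodic_polarPart_pi (c γ τ : ℂ) : Function.Periodic (polarPart c γ τ) π := fun z => by
  rw [polarPart, polarPart, periodic_X_pi, periodic_thetaQuotient_pi]

lemma discrepancy_neg_gamma_sub (a t : ℝ) (c τ : ℂ) (hγ : 0 < γ.im) (z : ℂ) :
    discrepancy a t c γ τ (-γ - z) = discrepancy a t c γ τ z := by
  rw [discrepancy, discrepancy, X_neg_gamma_sub, polarPart_neg_gamma_sub c τ hγ]

lemma periodic_discrepancy_pi (a t : ℝ) (c γ τ : ℂ) :
    Function.Periodic (discrepancy a t c γ τ) π := fun z => by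
  rw [discrepancy, discrepancy, periodic_X_pi, periodic_polarPart_pi]

lemma analyticAt_regularPart_X (hτ : 0 < τ.im) (hat : (|a| + 4) * |t| < 1) {z : ℂ}
    (hz : z ∈ domainX c γ τ) : AnalyticAt ℂ (fun z => regularPart a t (X c γ τ z)) z := by
  have hQ : AnalyticAt ℂ (fun x => Q a t x 0) (X c γ τ z) := (differentiableOn_Q hat).analyticAt
    (Metric.isOpen_ball.mem_nhds (mem_ball_zero_iff.2 hz.2))
  have hreg : AnalyticAt ℂ (regularPart a t) (X c γ τ z) := by
    unfold regularPart
    fun_prop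
  exact hreg.comp (analyticAt_X hτ hz.1)

namespace IsUniformizingTriple

variable (h : IsUniformizingTriple a t c γ τ)
include h

lemma tendsto_mul_one_div_X : Tendsto (fun z => z * (1 / X c γ τ z)) (𝓝[≠] 0)
    (𝓝 (-(theta (2 * γ) τ / (c * theta' 0 τ)))) := by
  have hτ := h.tau_im_pos
  have hc := h.c_ne_zero
  have hθγ := h.theta_gamma_ne_zero
  have hnum : Differentiable ℂ fun z => theta (z - γ) τ * theta (z + 2 * γ) τ := by
    fun_prop (disch := assumption)
  have hdenom : Differentiable ℂ fun z => c * theta (z + γ) τ := by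
    fun_prop (disch := assumption)
  convert tendsto_sub_mul_div ((hnum 0).fun_div (hdenom 0) (by simp [hc, hθγ])).continuousAt
    (differentiable_theta hτ 0).hasDerivAt (theta_zero τ) (theta'_zero_ne_zero hτ) using 2 with z
  · simp only [X, sub_zero, div_eq_mul_inv, mul_inv, inv_inv]
    ring
  · simp only [zero_add, zero_sub, theta_neg, theta']
    field_simp

lemma tendsto_mul_thetaQuotient : Tendsto (fun z => z * thetaQuotient c γ τ z) (𝓝[≠] 0)
    (𝓝 (theta (2 * γ) τ / (c * theta' 0 τ))) := by
  have hγπ := gamma_div_pi_im_pos h.gamma_im_pos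
  have hθ' := theta'_zero_ne_zero hγπ
  have hθ := theta_pi_div_two_ne_zero hγπ
  have hnum : Differentiable ℂ fun z => quotientConst c γ τ * theta (z + π / 2) (γ / π) := by
    fun_prop (disch := assumption)
  convert tendsto_sub_mul_div (hnum 0).continuousAt (differentiable_theta hγπ 0).hasDerivAt
    (theta_zero _) hθ' using 2 with z
  · rw [thetaQuotient_eq, sub_zero]
  · change _ = _ / theta' 0 (γ / π)
    rw [quotientConst, zero_add]
    field_simp

/-- The residues of `1 / X` and of the theta quotient at `0` are opposite: this is how the constant
factor of the theta quotient is determined. -/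
lemma meromorphicOrderAt_polarPart_zero : 0 ≤ meromorphicOrderAt (polarPart c γ τ) 0 := by
  have hX : MeromorphicAt (X c γ τ) 0 :=
    (h.analyticOnNhd_X_strip 0 (ofReal_mem_strip h.gamma_im_pos 0)).meromorphicAt
  refine meromorphicOrderAt_nonneg_of_tendsto (((MeromorphicAt.const 1 0).fun_div hX).fun_add
    (meromorphic_thetaQuotient c τ h.gamma_im_pos 0)) ?_
  simpa [polarPart, mul_add] using h.tendsto_mul_one_div_X.add h.tendsto_mul_thetaQuotient

lemma meromorphicOrderAt_polarPart_of_im {p : ℂ} (hp_lt : -γ.im < p.im) (hp_le : p.im ≤ 0) :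
    0 ≤ meromorphicOrderAt (polarPart c γ τ) p := by
  have hγ := h.gamma_im_pos
  have hγτ := h.two_gamma_im_lt
  by_cases hp : ∃ m : ℤ, p = m * π
  · obtain ⟨m, rfl⟩ := hp
    rw [((periodic_meromorphicOrderAt (periodic_polarPart_pi c γ τ)).int_mul m).eq]
    exact h.meromorphicOrderAt_polarPart_zero
  have hπγ := pi_mul_gamma_div_pi_im γ
  have hθ : theta p τ ≠ 0 := fun hθ => hp
    (exists_int_mul_pi_of_theta_eq_zero h.tau_im_pos hθ (by linarith) (by linarith))
  have hθπ : theta p (γ / π) ≠ 0 := fun hθπ => hp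
    (exists_int_mul_pi_of_theta_eq_zero (gamma_div_pi_im_pos hγ) hθπ (by linarith) (by linarith))
  have hX := h.analyticOnNhd_X_strip p ⟨hp_lt.le, hp_le⟩
  exact ((analyticAt_const.fun_div hX (h.X_ne_zero hp_lt hp_le hθ)).fun_add
    (analyticAt_thetaQuotient c τ hγ hθπ)).meromorphicOrderAt_nonneg

lemma meromorphicOrderAt_polarPart_nonneg {p : ℂ} (hp : p ∈ strip γ) :
    0 ≤ meromorphicOrderAt (polarPart c γ τ) p := by
  have hγ := h.gamma_im_pos
  rcases hp.1.eq_or_lt with hp_eq | hp_lt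
  · rw [← meromorphicOrderAt_neg_gamma_sub (polarPart_neg_gamma_sub c τ hγ)]
    exact h.meromorphicOrderAt_polarPart_of_im (by simpa [← hp_eq]) (by simp [← hp_eq])
  · exact h.meromorphicOrderAt_polarPart_of_im hp_lt hp.2

lemma meromorphicAt_polarPart {p : ℂ} (hp : p ∈ strip γ) : MeromorphicAt (polarPart c γ τ) p :=
  ((MeromorphicAt.const 1 p).fun_div (h.analyticOnNhd_X_strip p hp).meromorphicAt).fun_add
    (meromorphic_thetaQuotient c τ h.gamma_im_pos p)

lemma eventually_X_ne_zero {p : ℂ} (hp : p ∈ strip γ) : ∀ᶠ z in 𝓝[≠] p, X c γ τ z ≠ 0 := by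
  refine (h.analyticOnNhd_X_strip p hp).eventually_eq_zero_or_eventually_ne_zero.resolve_left
    fun hX => h.X_neg_half_gamma_ne_zero ?_
  exact h.analyticOnNhd_X_strip.eqOn_zero_of_preconnected_of_eventuallyEq_zero
    (convex_strip γ).isPreconnected hp hX (neg_half_mem_strip h.gamma_im_pos)

lemma discrepancy_neg (ha : a ≠ 0) (ht : t ≠ 0) (hat : (|a| + 4) * |t| < 1) {z : ℂ}
    (hz : z ∈ domainX c γ τ) (hz_neg : -z ∈ domainX c γ τ) (hX : X c γ τ z ≠ 0)
    (hX_neg : X c γ τ (-z) ≠ 0) : discrepancy a t c γ τ (-z) = -discrepancy a t c γ τ z := by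
  have hkernel := h.stepPoly_X_Y ha hX (by rwa [Y_eq_X_neg])
  rw [Y_eq_X_neg] at hkernel
  have hQ := Q_add_Q_eq_of_kernel ht hat hz.2.le hz_neg.2.le hX hX_neg hkernel
  rw [Q_swap a t 0] at hQ
  have htwo : 1 / (2 * (t : ℂ)) = (1 / t) / 2 := by rw [div_div, mul_comm]
  simp only [discrepancy, polarPart, regularPart, thetaQuotient_neg]
  rw [htwo, ← hkernel, stepPoly]
  linear_combination (-(a : ℂ)) * hQ

lemma eventually_discrepancy_neg (ha : a ≠ 0) (ht : t ≠ 0) (hat : (|a| + 4) * |t| < 1) (s : ℝ) :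
    ∀ᶠ z in 𝓝[≠] (s : ℂ), discrepancy a t c γ τ (-z) = -discrepancy a t c γ τ z := by
  have hgood (r : ℝ) : ∀ᶠ z in 𝓝[≠] (r : ℂ), z ∈ domainX c γ τ ∧ X c γ τ z ≠ 0 := by
    have hr := ofReal_mem_strip h.gamma_im_pos r
    exact (((isOpen_domainX c γ h.tau_im_pos).eventually_mem
      (h.strip_subset_domainX ha ht hat hr)).filter_mono nhdsWithin_le_nhds).and
      (h.eventually_X_ne_zero hr)
  have hneg : Tendsto (fun z : ℂ => -z) (𝓝[≠] s) (𝓝[≠] (-s : ℝ)) := by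
    rw [Complex.ofReal_neg]
    exact ((Homeomorph.neg ℂ).map_punctured_nhds_eq (s : ℂ)).le
  filter_upwards [hgood s, hneg.eventually (hgood (-s))] with z ⟨hz, hX⟩ ⟨hz_neg, hX_neg⟩
  exact h.discrepancy_neg ha ht hat hz hz_neg hX hX_neg

lemma meromorphicAt_discrepancy (ha : a ≠ 0) (ht : t ≠ 0) (hat : (|a| + 4) * |t| < 1) {p : ℂ}
    (hp : p ∈ strip γ) : MeromorphicAt (discrepancy a t c γ τ) p :=
  (analyticAt_regularPart_X h.tau_im_pos hat
    (h.strip_subset_domainX ha ht hat hp)).meromorphicAt.fun_sub (h.meromorphicAt_polarPart hp)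

lemma meromorphicOrderAt_discrepancy_nonneg (ha : a ≠ 0) (ht : t ≠ 0)
    (hat : (|a| + 4) * |t| < 1) {p : ℂ} (hp : p ∈ strip γ) :
    0 ≤ meromorphicOrderAt (discrepancy a t c γ τ) p := by
  have hreg := analyticAt_regularPart_X h.tau_im_pos hat (h.strip_subset_domainX ha ht hat hp)
  have hpolar := h.meromorphicAt_polarPart hp
  have hdisc : discrepancy a t c γ τ = (fun z => regularPart a t (X c γ τ z)) + -polarPart c γ τ :=
    funext fun z => sub_eq_add_neg _ _
  rw [hdisc]
  refine (le_min hreg.meromorphicOrderAt_nonneg ?_).trans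
    (meromorphicOrderAt_add hreg.meromorphicAt hpolar.neg)
  rw [← meromorphicOrderAt_neg]
  exact h.meromorphicOrderAt_polarPart_nonneg hp

lemma discrepancy_eventuallyEq_zero (ha : a ≠ 0) (ht : t ≠ 0) (hat : (|a| + 4) * |t| < 1) :
    discrepancy a t c γ τ =ᶠ[𝓝[≠] (-(γ / 2))] 0 := by
  have hγ := h.gamma_im_pos
  obtain ⟨G, hG, hdisc⟩ := exists_analyticOnNhd_eventuallyEq (U := strip γ)
    (fun z hz => h.meromorphicAt_discrepancy ha ht hat hz)
    (fun z hz => h.meromorphicOrderAt_discrepancy_nonneg ha ht hat hz)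
  have hcomp (φ : ℂ ≃ₜ ℂ) {σ : ℂ → ℂ} (hσ : Continuous σ) {z : ℂ} (hz : z ∈ strip γ)
      (hφz : φ z ∈ strip γ)
      (hF : ∀ᶠ w in 𝓝[≠] z, discrepancy a t c γ τ (φ w) = σ (discrepancy a t c γ τ w)) :
      G ∘ φ =ᶠ[𝓝 z] σ ∘ G :=
    comp_homeomorph_eventuallyEq φ hσ hF (hdisc z hz) (hdisc _ hφz) (hG z hz).continuousAt
      (hG _ hφz).continuousAt
  have hzero : EqOn G 0 (strip γ) := by
    refine eqOn_zero_strip_of_odd hγ hG (fun z hz => ?_) (fun z hz => ?_) fun s => ?_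
    · exact (hcomp (Homeomorph.addRight (π : ℂ)) continuous_id hz (by simpa [strip] using hz)
        (.of_forall (periodic_discrepancy_pi a t c γ τ))).eq_of_nhds
    · exact (hcomp (Homeomorph.subLeft (-γ)) continuous_id hz (neg_gamma_sub_mem_strip hz)
        (.of_forall (discrepancy_neg_gamma_sub a t c τ hγ))).eq_of_nhds
    · exact hcomp (Homeomorph.neg ℂ) continuous_neg (ofReal_mem_strip hγ s)
        (by simpa using! ofReal_mem_strip hγ (-s)) (h.eventually_discrepancy_neg ha ht hat s)
  have hstrip : strip γ ∈ 𝓝 (-(γ / 2)) := strip_mem_nhds (by simpa) (by simpa)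
  exact (hdisc _ (neg_half_mem_strip hγ)).trans
    (eventually_nhdsWithin_of_eventually_nhds (mem_of_superset hstrip hzero))

end IsUniformizingTriple
end Discrepancy

section DecoupledFunction

variable {a t : ℝ} {c γ τ : ℂ}

namespace IsUniformizingTriple

variable (h : IsUniformizingTriple a t c γ τ)
include h

lemma quotientConst_ne_zero : quotientConst c γ τ ≠ 0 :=
  have hγπ := gamma_div_pi_im_pos h.gamma_im_pos
  div_ne_zero (mul_ne_zero (theta'_zero_ne_zero hγπ) h.theta_two_gamma_ne_zero)
    (mul_ne_zero (mul_ne_zero h.c_ne_zero (theta_pi_div_two_ne_zero hγπ))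
      (theta'_zero_ne_zero h.tau_im_pos))

lemma regularPart_X_mul_theta_eq (ha : a ≠ 0) (ht : t ≠ 0) (hat : (|a| + 4) * |t| < 1) {z : ℂ}
    (hz : z ∈ regionX c γ τ) :
    (regularPart a t (X c γ τ z) * X c γ τ z - 1) * theta z (γ / π) =
      quotientConst c γ τ * X c γ τ z * theta (z + π / 2) (γ / π) := by
  have hγ := h.gamma_im_pos
  have hτ := h.tau_im_pos
  have hγπ := gamma_div_pi_im_pos hγ
  have hπγ := pi_mul_gamma_div_pi_im γ
  have hhalf := neg_half_mem_strip hγ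
  have hθ : theta (-(γ / 2)) (γ / π) ≠ 0 :=
    theta_ne_zero_of_im hγπ (-1) (by rw [hπγ]; simp; linarith) (by simp; linarith)
  have hX : AnalyticOnNhd ℂ (X c γ τ) (regionX c γ τ) :=
    (analyticOnNhd_X_domainX c γ hτ).mono (regionX_subset c γ τ)
  have hθ_diff (s : ℂ) : Differentiable ℂ fun z => theta (z + s) (γ / π) := by
    fun_prop (disch := assumption)
  have hreg : AnalyticOnNhd ℂ (fun z => regularPart a t (X c γ τ z)) (regionX c γ τ) :=
    fun w hw => analyticAt_regularPart_X hτ hat (regionX_subset c γ τ hw)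
  refine AnalyticOnNhd.eqOn_of_preconnected_of_frequently_eq
    (((hreg.mul hX).sub analyticOnNhd_const).mul fun w _ => (differentiable_theta hγπ).analyticAt w)
    ((analyticOnNhd_const.mul hX).mul fun w _ => (hθ_diff _).analyticAt w)
    isPreconnected_connectedComponentIn (h.strip_subset_regionX ha ht hat hhalf)
    (Eventually.frequently ?_) hz
  filter_upwards [h.discrepancy_eventuallyEq_zero ha ht hat, h.eventually_X_ne_zero hhalf,
    ((differentiable_theta hγπ).continuous.continuousAt.eventually_ne hθ).filter_mono
      nhdsWithin_le_nhds] with w hdisc hXw hθw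
  rw [discrepancy, polarPart, thetaQuotient_eq, Pi.zero_apply] at hdisc
  simp only [Pi.sub_apply]
  generalize theta (w + π / 2) (γ / π) = θ₂ at hdisc ⊢
  field_simp at hdisc
  linear_combination hdisc

lemma thetaQuotient_eq_on_regionX (ha : a ≠ 0) (ht : t ≠ 0) (hat : (|a| + 4) * |t| < 1) {z : ℂ}
    (hz : z ∈ regionX c γ τ) (hX : X c γ τ z ≠ 0) :
    thetaQuotient c γ τ z = regularPart a t (X c γ τ z) - 1 / X c γ τ z := by
  have hγπ := gamma_div_pi_im_pos h.gamma_im_pos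
  have hidentity := h.regularPart_X_mul_theta_eq ha ht hat hz
  have hθ : theta z (γ / π) ≠ 0 := by
    intro hθ
    rw [hθ, mul_zero] at hidentity
    exact mul_ne_zero (mul_ne_zero h.quotientConst_ne_zero hX)
      (theta_add_ne_zero hγπ hθ (theta_pi_div_two_ne_zero hγπ)) hidentity.symm
  rw [thetaQuotient_eq]
  generalize theta (z + π / 2) (γ / π) = θ₂ at hidentity ⊢
  field_simp
  linear_combination -hidentity

theorem isDecoupledFunction_thetaQuotient (ha : a ≠ 0) (ht : t ≠ 0) (hat : (|a| + 4) * |t| < 1) :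
    IsDecoupledFunction a t c γ τ (thetaQuotient c γ τ) where
  meromorphic := meromorphic_thetaQuotient c τ h.gamma_im_pos
  eq_on_regionX z hz hX := by rw [h.thetaQuotient_eq_on_regionX ha ht hat hz hX, regularPart]
  eq_on_regionY z hz hY := by
    rw [Y_eq_X_neg] at hY ⊢
    have hquot := h.thetaQuotient_eq_on_regionX ha ht hat (neg_mem_regionX hz) hY
    rw [thetaQuotient_neg, regularPart] at hquot
    rw [Q_swap a t 0]
    linear_combination -hquot

end IsUniformizingTriple

lemma eventually_codiscrete_eq_of_eventuallyEq {F G : ℂ → ℂ} {p : ℂ} (hF : Meromorphic F)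
    (hG : Meromorphic G) (hFG : F =ᶠ[𝓝[≠] p] G) : ∀ᶠ z in codiscrete ℂ, F z = G z := by
  have htop_at : meromorphicOrderAt (F - G) p = ⊤ :=
    meromorphicOrderAt_eq_top_iff.2 (hFG.mono fun z hz => sub_eq_zero.2 hz)
  have htop (z : ℂ) : meromorphicOrderAt (F - G) z = ⊤ := by
    by_contra hz
    exact (hF.sub hG).exists_meromorphicOrderAt_ne_top_iff_forall.1 ⟨z, hz⟩ p htop_at
  rw [Filter.Eventually, mem_codiscrete]
  intro z
  rw [disjoint_principal_right, compl_compl]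
  exact (meromorphicOrderAt_eq_top_iff.1 (htop z)).mono fun w hw => sub_eq_zero.1 hw

theorem IsDecoupledFunction.eventually_codiscrete_eq {J₁ J₂ : ℂ → ℂ}
    (h₁ : IsDecoupledFunction a t c γ τ J₁) (h₂ : IsDecoupledFunction a t c γ τ J₂)
    (h : IsUniformizingTriple a t c γ τ) (ha : a ≠ 0) (ht : t ≠ 0) (hat : (|a| + 4) * |t| < 1) :
    ∀ᶠ z in codiscrete ℂ, J₁ z = J₂ z := by
  have hhalf := neg_half_mem_strip h.gamma_im_pos
  refine eventually_codiscrete_eq_of_eventuallyEq (p := -(γ / 2)) h₁.meromorphic h₂.meromorphic ?_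
  filter_upwards [h.eventually_X_ne_zero hhalf, ((isOpen_regionX c γ h.tau_im_pos).eventually_mem
    (h.strip_subset_regionX ha ht hat hhalf)).filter_mono nhdsWithin_le_nhds] with z hX hz
  rw [h₁.eq_on_regionX z hz hX, h₂.eq_on_regionX z hz hX]

end DecoupledFunction

end QuadrantWalk

theorem mainTheorem4_general {a t : ℝ} (ha : a ≠ 0) (ht : t ≠ 0) (hat : (|a| + 4) * |t| < 1)
    {c γ τ : ℂ} (h : QuadrantWalk.IsUniformizingTriple a t c γ τ) :
    QuadrantWalk.IsDecoupledFunction a t c γ τ (QuadrantWalk.thetaQuotient c γ τ) ∧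
    (∀ J : ℂ → ℂ, QuadrantWalk.IsDecoupledFunction a t c γ τ J →
      ∀ᶠ z in Filter.codiscrete ℂ, J z = QuadrantWalk.thetaQuotient c γ τ z) ∧
    (∀ x : ℂ, x ≠ 0 → ‖x‖ < 1 →
      (∃ z ∈ QuadrantWalk.regionX c γ τ, QuadrantWalk.X c γ τ z = x) ∧
      ∀ z ∈ QuadrantWalk.regionX c γ τ, QuadrantWalk.X c γ τ z = x →
        QuadrantWalk.Q a t x 0 =
          (1 / (2 * t) - x - 1 / x - QuadrantWalk.thetaQuotient c γ τ z) / (a * t * x)) := by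
  have hJ := h.isDecoupledFunction_thetaQuotient ha ht hat
  refine ⟨hJ, fun J hJ' => hJ'.eventually_codiscrete_eq hJ h ha ht hat,
    fun x hx hx_lt => ⟨h.exists_mem_regionX ha ht hat hx_lt, ?_⟩⟩
  rintro z hz rfl
  rw [hJ.eq_on_regionX z hz hx, eq_div_iff (by simp [ha, ht, hx])]
  ring

theorem mainTheorem4 (a t : ℝ) (ha : 0 < a) (ht : 0 < t) (hta : t < 1 / (a + 4))
    (c γ τ : ℂ) (h : QuadrantWalk.IsUniformizingTriple a t c γ τ) :
    QuadrantWalk.IsDecoupledFunction a t c γ τ (QuadrantWalk.thetaQuotient c γ τ) ∧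
    (∀ J : ℂ → ℂ, QuadrantWalk.IsDecoupledFunction a t c γ τ J →
      ∀ᶠ z in Filter.codiscrete ℂ, J z = QuadrantWalk.thetaQuotient c γ τ z) ∧
    (∀ x : ℂ, x ≠ 0 → ‖x‖ < 1 →
      (∃ z ∈ QuadrantWalk.regionX c γ τ, QuadrantWalk.X c γ τ z = x) ∧
      ∀ z ∈ QuadrantWalk.regionX c γ τ, QuadrantWalk.X c γ τ z = x →
        QuadrantWalk.Q a t x 0 =
          (1 / (2 * t) - x - 1 / x - QuadrantWalk.thetaQuotient c γ τ z) / (a * t * x)) :=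
  mainTheorem4_general ha.ne' ht.ne'
    (by rwa [abs_of_pos ha, abs_of_pos ht, ← lt_div_iff₀' (by positivity)]) h
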